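/- Let $T$ be a complete first-order theory in a language $L$, let $|T| = \max(\aleph_0, |L|)$, and let $\mathbb{M} \models T$ be a monster model: $\mathbb{M}$ is $\bar\kappa$-saturated and strongly $\bar\kappa$-homogeneous for some cardinal $\bar\kappa > |T|^+$. A subset of $\mathbb{M}$ is small if its cardinality is $< \bar\kappa$; below, $A, A', B, B'$ are small sets and $M$ is a small elementary submodel of $\mathbb{M}$. For sets, $A \equiv_C A'$ means that suitable enumerations of $A$ and $A'$ have the same type over $C$. An independence relation is an $\mathrm{Aut}(\mathbb{M})$-invariant ternary relation $A \mathop{\perp}_M B$. It satisfies - full existence if for all $A, B, M$ there is $A' \equiv_M A$ with $A' \perp_M B$; - monotonicity if $A \perp_M B$, $A' \subseteq A$, $B' \subseteq B$ imply $A' \perp_M B'$; - strong finite character if, whenever $A \not\perp_M B$ and $a$ enumerates $A$, there is a formula $\phi(x) \in \mathrm{tp}(a/MB)$ such that $a' \not\perp_M B$ for all $a' \models \phi$; - right extension if $A \perp_M B \subseteq B'$ implies that there is $A' \equiv_{MB} A$ with $A' \perp_M B'$; - chain local character if, for every finite $A$, every regular cardinal $\kappa$ with $|T| < \kappa < \bar\kappa$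 and every continuous increasing chain $(M_i)_{i<\kappa}$ of elementary submodels of $\mathbb{M}$ with $|M_i| < \kappa$ for all $i<\kappa$, there is $i < \kappa$ with $A \perp_{M_i} \bigcup_{j<\kappa} M_j$. A global type $q$ is $\perp$-free over $M$ if $a \perp_M B$ for all small $B$ and all $a \models q|_{MB}$. A sequence $(b_i)_{i<\omega}$ is a Morley sequence in $q$ over $M$ if $b_i \models q|_{M b_{<i}}$ for all $i$. For an $L_M$-formula $\phi(x,y)$ and a finite tuple $b$, the formula $\phi(x,b)$ $\perp$-Conant-divides over $M$ if, for every global extension $q$ of $\mathrm{tp}(b/M)$ that is $\perp$-free over $M$ and every $M$-indiscernible Morley sequence $(b_i)_{i<\omega}$ in $q$ over $M$ with $b_0 = b$, the set $\{\phi(x,b_i) : i<\omega\}$ is inconsistent. A formula $\perp$-Conant-forks over $M$ if it implies a finite disjunction of formulas that $\perp$-Conant-divide over $M$. The set $A$ is $\perp$-Conant-independent from $B$ over $M$ if no formula in $\mathrm{tp}(a/MB)$, where $a$ enumerates $A$, $\perp$-Conant-forks over $M$. Conant-independence is $\perp^{\mathrm{i}}$-Conant-independence, where $A \perp^{\mathrm{i}}_M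 B$ means that $\mathrm{tp}(a/MB)$ extends to a global $\mathrm{Aut}(\mathbb{M}/M)$-invariant type. **Corollary.** If $\perp$ is an independence relation satisfying full existence, monotonicity, strong finite character and right extension, then $\perp$-Conant-independence satisfies chain local character. In particular, for every $T$ and $\mathbb{M}$ as above, Conant-independence satisfies chain local character. -/

import Mathlib

universe u v w w'

namespace AbsIndep

open FirstOrder FirstOrder.Language Cardinal Set

section Monster

variable (L : FirstOrder.Language.{u, v}) (𝕄 : Type w) [L.Structure 𝕄]

/-- `|T|`, the number of formulas of the language up to renaming of variables:
the maximum of `ℵ₀` and the number of symbols. -/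
noncomputable def theoryCard : Cardinal.{max u v} := max ℵ₀ L.card

/-- `𝕄` is a monster model (of its complete theory) with respect to the cardinal `κ`:
`κ > |T|⁺`, and `𝕄` is `κ`-saturated and strongly `κ`-homogeneous.
The small sets are the subsets of `𝕄` of cardinality `< κ`; the small models of the theory
are the elementary substructures of `𝕄` of cardinality `< κ`. -/
structure IsMonster (κ : Cardinal.{w}) : Prop where
  card_lt : Cardinal.lift.{w} (Order.succ (theoryCard L)) < Cardinal.lift.{max u v} κ
  saturated : ∀ C : Set 𝕄, #C < κ → ∀ (n : ℕ) (p : Set (L[[C]].Formula (Fin n))),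
    (∀ s : Finset (L[[C]].Formula (Fin n)), (s : Set (L[[C]].Formula (Fin n))) ⊆ p →
      ∃ a : Fin n → 𝕄, ∀ φ ∈ s, φ.Realize a) →
    ∃ a : Fin n → 𝕄, ∀ φ ∈ p, φ.Realize a
  homogeneous : ∀ C : Set 𝕄, #C < κ → ∀ f : C → 𝕄,
    (∀ φ : L.Formula C, φ.Realize (fun c => (c : 𝕄)) ↔ φ.Realize f) →
    ∃ σ : 𝕄 ≃[L] 𝕄, ∀ c : C, σ c = f c

end Monster

section Types

variable (L : FirstOrder.Language.{u, v}) {𝕄 : Type w} [L.Structure 𝕄] {ι : Type w'}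

/-- `a ≡_C a'` for tuples: `tp(a/C) = tp(a'/C)`. -/
def SameType (C : Set 𝕄) (a a' : ι → 𝕄) : Prop :=
  ∀ φ : L[[C]].Formula ι, φ.Realize a ↔ φ.Realize a'

/-- `A ≡_C A'` for sets: the enumeration of `A` by its own elements has the same type over `C`
as some enumeration of `A'`. -/
def SetSameType (C A A' : Set 𝕄) : Prop :=
  ∃ f : A → 𝕄, range f = A' ∧ SameType L C (fun x : A => (x : 𝕄)) f

variable (𝕄) in
/-- Global types in the variables `ι`: complete types over `𝕄`. -/
abbrev GlobalType (ι : Type w') := (L.elementaryDiagram 𝕄).CompleteType ι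

variable {L}

/-- The formula `φ` with parameters in `𝕄` belongs to the global type `p`. -/
def GlobalType.Contains (p : GlobalType L 𝕄 ι) (φ : L[[𝕄]].Formula ι) : Prop :=
  Formula.equivSentence φ ∈ p

/-- `a ⊨ p|_C`. For `C = M` this says equally that `p` extends `tp(a/M)`. -/
def GlobalType.RealizesRestrict (p : GlobalType L 𝕄 ι) (C : Set 𝕄) (a : ι → 𝕄) : Prop :=
  ∀ φ : L[[C]].Formula ι,
    p.Contains ((L.lhomWithConstantsMap (Subtype.val : C → 𝕄)).onFormula φ) → φ.Realize a

/-- `p` is invariant under `Aut(𝕄/C)`. -/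
def GlobalType.IsInvariant (p : GlobalType L 𝕄 ι) (C : Set 𝕄) : Prop :=
  ∀ σ : 𝕄 ≃[L] 𝕄, (∀ c ∈ C, σ c = c) → ∀ φ : L[[𝕄]].Formula ι,
    p.Contains φ ↔ p.Contains ((L.lhomWithConstantsMap σ).onFormula φ)

/-- `(a_i)_{i<ω}` is a Morley sequence in `p` over `C`: `a_i ⊨ p|_{C a_{<i}}` for all `i`. -/
def IsMorleyIn (p : GlobalType L 𝕄 ι) (C : Set 𝕄) (a : ℕ → ι → 𝕄) : Prop :=
  ∀ i, p.RealizesRestrict (C ∪ ⋃ j < i, range (a j)) (a i)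

variable (L) in
/-- The sequence of tuples `(a_i)_{i<ω}` is (order-)indiscernible over `C`. -/
def IsIndiscernible (C : Set 𝕄) (a : ℕ → ι → 𝕄) : Prop :=
  ∀ (n : ℕ) (i j : Fin n → ℕ), StrictMono i → StrictMono j →
    SameType L C (fun x : Fin n × ι => a (i x.1) x.2) (fun x : Fin n × ι => a (j x.1) x.2)

end Types

/-- Ternary relations between subsets of `𝕄`; `Ind A C B` is read `A ⫝_C B`. Only the values at
small `A`, `B` and small models `C` matter below. -/
abbrev TernaryRel (𝕄 : Type w) := Set 𝕄 → Set 𝕄 → Set 𝕄 → Prop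

section Properties

variable (L : FirstOrder.Language.{u, v}) {𝕄 : Type w} [L.Structure 𝕄] (κ : Cardinal.{w})
  (Ind : TernaryRel 𝕄)

/-- Independence relations: the `Aut(𝕄)`-invariant ternary relations. -/
def IsIndependenceRelation : Prop :=
  ∀ (σ : 𝕄 ≃[L] 𝕄) (A C B : Set 𝕄), Ind A C B → Ind (σ '' A) (σ '' C) (σ '' B)

def FullExistence : Prop :=
  ∀ (M : L.ElementarySubstructure 𝕄) (A B : Set 𝕄),
    #(M : Set 𝕄) < κ → #A < κ → #B < κ → ∃ A', SetSameType L M A A' ∧ Ind A' M B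

def LeftMonotonicity : Prop :=
  ∀ (M : L.ElementarySubstructure 𝕄) (A A' B : Set 𝕄),
    #(M : Set 𝕄) < κ → #A < κ → #B < κ → Ind A M B → A' ⊆ A → Ind A' M B

def RightMonotonicity : Prop :=
  ∀ (M : L.ElementarySubstructure 𝕄) (A B B' : Set 𝕄),
    #(M : Set 𝕄) < κ → #A < κ → #B < κ → Ind A M B → B' ⊆ B → Ind A M B'

def Monotonicity : Prop := LeftMonotonicity L κ Ind ∧ RightMonotonicity L κ Ind

/-- If not `A ⫝_M B`, then some formula in `tp(A/MB)` implies dependence from `B` over `M`. -/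
def StrongFiniteCharacter : Prop :=
  ∀ (M : L.ElementarySubstructure 𝕄) (A B : Set 𝕄),
    #(M : Set 𝕄) < κ → #A < κ → #B < κ → ¬ Ind A M B →
    ∃ φ : L[[((M : Set 𝕄) ∪ B : Set 𝕄)]].Formula A,
      φ.Realize (fun x : A => (x : 𝕄)) ∧
      ∀ a' : A → 𝕄, φ.Realize a' → ¬ Ind (range a') M B

def RightExtension : Prop :=
  ∀ (M : L.ElementarySubstructure 𝕄) (A B B' : Set 𝕄),
    #(M : Set 𝕄) < κ → #A < κ → #B < κ → #B' < κ → Ind A M B → B ⊆ B' →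
    ∃ A', SetSameType L ((M : Set 𝕄) ∪ B) A A' ∧ Ind A' M B'

/-- `(M_i)_{i<μ}` is a continuous chain of models (only the values at ordinals `i < μ` matter). -/
def IsContinuousChain (μ : Cardinal.{w}) (M : Ordinal.{w} → L.ElementarySubstructure 𝕄) : Prop :=
  (∀ i j, i ≤ j → j < μ.ord → (M i : Set 𝕄) ⊆ M j) ∧
  (∀ i, i < μ.ord → Order.IsSuccLimit i → (M i : Set 𝕄) = ⋃ j < i, (M j : Set 𝕄))

/-- Chain local character: for every finite `A` and every regular cardinal `μ > |T|` (small with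
respect to the monster), every continuous chain `(M_i)_{i<μ}` of models of cardinality `< μ`
has a member `M_i` such that `A ⫝_{M_i} ⋃_{j<μ} M_j`. -/
def ChainLocalCharacter : Prop :=
  ∀ A : Set 𝕄, A.Finite → ∀ μ : Cardinal.{w}, μ.IsRegular → μ < κ →
    Cardinal.lift.{w} (theoryCard L) < Cardinal.lift.{max u v} μ →
    ∀ M : Ordinal.{w} → L.ElementarySubstructure 𝕄, IsContinuousChain L μ M →
      (∀ i < μ.ord, #(M i : Set 𝕄) < μ) →
      ∃ i < μ.ord, Ind A (M i) (⋃ j < μ.ord, (M j : Set 𝕄))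

end Properties

section Conant

variable {L : FirstOrder.Language.{u, v}} {𝕄 : Type w} [L.Structure 𝕄] (κ : Cardinal.{w})
  (Ind : TernaryRel 𝕄)

/-- The global type `p` is `⫝`-free over `M`: if `B` is small and `a ⊨ p|_{MB}`,
then `a ⫝_M B`. -/
def IsFree {ι : Type w'} (p : GlobalType L 𝕄 ι) (M : Set 𝕄) : Prop :=
  ∀ B : Set 𝕄, #B < κ → ∀ a : ι → 𝕄, p.RealizesRestrict (M ∪ B) a → Ind (range a) M B

/-- `φ(x, b)` `⫝`-Conant-divides over `M`, where `φ(x, y)` has parameters in `M`: for every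
`⫝`-free global extension `q` of `tp(b/M)` and every `M`-indiscernible Morley sequence `(b_i)`
in `q` over `M` with `b_0 = b`, some finite part of `{φ(x, b_i) : i < ω}` has no solution. -/
def ConantDivides {α : Type w'} {m : ℕ} (M : Set 𝕄) (φ : L[[M]].Formula (α ⊕ Fin m))
    (b : Fin m → 𝕄) : Prop :=
  ∀ q : GlobalType L 𝕄 (Fin m), q.RealizesRestrict M b → IsFree κ Ind q M →
    ∀ c : ℕ → Fin m → 𝕄, IsMorleyIn q M c → IsIndiscernible L M c → c 0 = b →
      ∃ s : Finset ℕ, ¬ ∃ x : α → 𝕄, ∀ i ∈ s, φ.Realize (Sum.elim x (c i))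

/-- `φ` (a formula with parameters in `D`) `⫝`-Conant-forks over `M`: it implies a finite
disjunction of formulas `ψ_i(x, c_i)` each of which `⫝`-Conant-divides over `M`. -/
def ConantForks {α : Type w'} (M : Set 𝕄) {D : Set 𝕄} (φ : L[[D]].Formula α) : Prop :=
  ∃ (n : ℕ) (m : Fin n → ℕ) (ψ : ∀ i, L[[M]].Formula (α ⊕ Fin (m i)))
    (c : ∀ i, Fin (m i) → 𝕄),
    (∀ i, ConantDivides κ Ind M (ψ i) (c i)) ∧
    ∀ x : α → 𝕄, φ.Realize x → ∃ i, (ψ i).Realize (Sum.elim x (c i))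

variable (L)

/-- `⫝`-Conant-independence: no formula of `tp(A/MB)` `⫝`-Conant-forks over `M`. -/
def ConantIndep : TernaryRel 𝕄 := fun A M B =>
  ¬ ∃ φ : L[[(M ∪ B : Set 𝕄)]].Formula A,
    φ.Realize (fun x : A => (x : 𝕄)) ∧ ConantForks κ Ind M φ

/-- `A ⫝ⁱ_M B`: `tp(A/MB)` extends to a global `M`-invariant type. -/
def InvIndep : TernaryRel 𝕄 := fun A M B =>
  ∃ q : GlobalType L 𝕄 A, q.IsInvariant M ∧ q.RealizesRestrict (M ∪ B) (fun x : A => (x : 𝕄))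

end Conant

end AbsIndep

-- Some stage `N` of the chain reflects: every set definable over `N ∪ A` with a point in the union
-- `C` of the chain has a point in `N` (`exists_reflecting`). Fewer than `μ` sets are definable over
-- a stage together with `A`, so their witnesses lie in a later stage. Closing off `ω` times gives a
-- limit stage, which by continuity is the union of its predecessors.
--
-- Suppose a formula `φ(x, c)` true of `A`, with `c` in `C`, implies a disjunction of
-- Conant-dividing formulas `ψ_k(x, d_k)`. Seek `e` with the type of `(c, d)` over `N`, independent
-- from `A` over `N`, such that `A` satisfies `φ` with the part of `e` that corresponds to `c`.
-- Strong finite character makes this a partial type. Each finite part of it has a solution in `N`,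
-- by reflection and elementarity, since full existence makes subsets of `N` independent from
-- everything. An automorphism over `N` taking `e` to `(c, d)` moves `A` to a solution of some
-- `ψ_k(x, d_k)` from which `d_k` is independent (`conantIndep_of_reflecting`).
--
-- Such a `ψ_k(x, d_k)` cannot Conant-divide (`IsIndepOver.not_conantDivides`). If `b` is
-- independent from `E` over `M`, Erdős–Rado applied to very long free sequences yields a sequence
-- starting with `b`, indiscernible over `M ∪ E`, each member independent from `E` and its
-- predecessors. By right extension and compactness it is a Morley sequence in a free global type. A
-- solution inside `E` then solves every instance. The long sequences may outrun the saturation of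
-- `𝕄`, so they are represented by ultrafilters.

universe x y

namespace AbsIndep

open FirstOrder FirstOrder.Language Cardinal Set Filter

/-! ### Types and parameters in terms of definable sets. -/

section Definable

variable {L : FirstOrder.Language.{u, v}} {𝕄 : Type w} [L.Structure 𝕄]
  {α : Type x} {β : Type y} {C D : Set 𝕄}

theorem sameType_iff_definable {a a' : α → 𝕄} :
    SameType L C a a' ↔ ∀ S : Set (α → 𝕄), C.Definable L S → (a ∈ S ↔ a' ∈ S) := by
  constructor
  · rintro h S ⟨φ, rfl⟩
    exact h φ
  · intro h φ
    exact h _ ⟨φ, rfl⟩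

theorem sameType_of_definable_imp {a a' : α → 𝕄}
    (h : ∀ S : Set (α → 𝕄), C.Definable L S → a ∈ S → a' ∈ S) : SameType L C a a' := by
  rw [sameType_iff_definable]
  intro S hS
  refine ⟨h S hS, fun ha' => ?_⟩
  by_contra ha
  exact h Sᶜ hS.compl ha ha'

theorem SameType.mono {a a' : α → 𝕄} (h : SameType L C a a') (hDC : D ⊆ C) :
    SameType L D a a' := by
  rw [sameType_iff_definable] at h ⊢
  exact fun S hS => h S (hS.mono hDC)

theorem SameType.comp {a a' : α → 𝕄} (h : SameType L C a a') (f : β → α) :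
    SameType L C (a ∘ f) (a' ∘ f) := by
  rw [sameType_iff_definable] at h ⊢
  exact fun S hS => h _ (hS.preimage_comp f)

theorem SameType.symm {a a' : α → 𝕄} (h : SameType L C a a') : SameType L C a' a :=
  fun φ => (h φ).symm

theorem SameType.trans {a a' a'' : α → 𝕄} (h : SameType L C a a') (h' : SameType L C a' a'') :
    SameType L C a a'' :=
  fun φ => (h φ).trans (h' φ)

theorem definable_fiber {S : Set (α ⊕ β → 𝕄)} (hS : C.Definable L S) (e : β → 𝕄) :
    (C ∪ range e).Definable L {x : α → 𝕄 | Sum.elim x e ∈ S} := by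
  rw [definable_iff_exists_formula_sum] at hS ⊢
  obtain ⟨φ, rfl⟩ := hS
  refine ⟨φ.relabel (Sum.elim (fun c : C => Sum.inl ⟨c, Or.inl c.2⟩)
    (Sum.elim Sum.inr fun b => Sum.inl ⟨e b, Or.inr ⟨b, rfl⟩⟩)), ?_⟩
  ext x
  simp only [mem_ofPred_eq, Formula.realize_relabel]
  apply iff_of_eq
  congr 1
  ext i
  rcases i with i | i | i <;> rfl

/-- Each parameter is named either by an element of `C` or by a coordinate of `e`; names of the
second kind become variables. -/
theorem exists_definable_fiber {s : Set (α → 𝕄)} {e : β → 𝕄}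
    (hs : (C ∪ range e).Definable L s) :
    ∃ S : Set (α ⊕ β → 𝕄), C.Definable L S ∧ s = {x | Sum.elim x e ∈ S} := by
  classical
  rw [definable_iff_exists_formula_sum] at hs
  obtain ⟨φ, rfl⟩ := hs
  have key : ∀ c : ↥(C ∪ range e), ∃ i : C ⊕ β, Sum.elim (↑) e i = (c : 𝕄) := by
    rintro ⟨c, hc | ⟨b, rfl⟩⟩
    · exact ⟨Sum.inl ⟨c, hc⟩, rfl⟩
    · exact ⟨Sum.inr b, rfl⟩
  choose g hg using key
  refine ⟨{v | (φ.relabel (Sum.elim (fun c => (g c).map id Sum.inr) fun a => Sum.inr (Sum.inl a)) :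
    L.Formula (C ⊕ (α ⊕ β))).Realize (Sum.elim (↑) v)},
    definable_iff_exists_formula_sum.2 ⟨_, rfl⟩, ?_⟩
  ext x
  simp only [mem_ofPred_eq, Formula.realize_relabel]
  apply iff_of_eq
  congr 1
  ext i
  rcases i with i | i
  · have := hg i
    simp only [Function.comp_apply, Sum.elim_inl]
    rw [← this]
    cases g i <;> rfl
  · rfl

theorem SameType.union_range {a a' : α → 𝕄} {e : β → 𝕄}
    (h : SameType L C (Sum.elim a e) (Sum.elim a' e)) : SameType L (C ∪ range e) a a' := by
  rw [sameType_iff_definable] at h ⊢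
  intro S hS
  obtain ⟨S', hS', rfl⟩ := exists_definable_fiber hS
  exact h S' hS'

theorem mem_definable_equiv_iff {S : Set (α → 𝕄)} (hS : C.Definable L S) (σ : 𝕄 ≃[L] 𝕄)
    (hσ : ∀ c ∈ C, σ c = c) (x : α → 𝕄) : σ ∘ x ∈ S ↔ x ∈ S := by
  rw [definable_iff_exists_formula_sum] at hS
  obtain ⟨φ, rfl⟩ := hS
  have := StrongHomClass.realize_formula σ φ (v := Sum.elim (fun c : C => (c : 𝕄)) x)
  rw [mem_ofPred_eq, mem_ofPred_eq, ← this]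
  apply iff_of_eq
  congr 1
  ext i
  rcases i with i | i
  · exact (hσ i i.2).symm
  · rfl

theorem image_equiv_eq_self (σ : 𝕄 ≃[L] 𝕄) (hσ : ∀ c ∈ C, σ c = c) : σ '' C = C := by
  have : σ '' C = id '' C := image_congr hσ
  rwa [image_id] at this

theorem sameType_equiv (σ : 𝕄 ≃[L] 𝕄) (hσ : ∀ c ∈ C, σ c = c) (x : α → 𝕄) :
    SameType L C x (σ ∘ x) :=
  sameType_iff_definable.2 fun _ hS => (mem_definable_equiv_iff hS σ hσ x).symm

/-- The existential closure passes down to `M`, and a witness found there passes back up. -/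
theorem definable_elementary {M : L.ElementarySubstructure 𝕄} [Finite α] {S : Set (α → 𝕄)}
    (hS : (M : Set 𝕄).Definable L S) (hne : S.Nonempty) : ∃ x ∈ S, ∀ i, x i ∈ M := by
  rw [definable_iff_exists_formula_sum] at hS
  obtain ⟨φ, rfl⟩ := hS
  obtain ⟨x, hx⟩ := hne
  have h1 : (φ.iExs α).Realize (fun c : (M : Set 𝕄) => (c : 𝕄)) := by
    simp only [Formula.realize_iExs]
    exact ⟨x, hx⟩
  have h2 : (φ.iExs α).Realize (fun c : M => c) :=
    (M.subtype.map_formula (φ.iExs α) (fun c : M => c)).1 h1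
  rw [Formula.realize_iExs] at h2
  obtain ⟨y, hy⟩ := h2
  refine ⟨fun i => y i, ?_, fun i => (y i).2⟩
  rw [← M.subtype.map_formula] at hy
  rw [mem_ofPred_eq]
  convert! hy using 1
  ext i
  rcases i with i | i <;> rfl

end Definable

/-! ### Saturation and homogeneity of the monster model for finite tuples. -/

section Monster

variable {L : FirstOrder.Language.{u, v}} {𝕄 : Type w} [L.Structure 𝕄]
  {κ : Cardinal.{w}} {α : Type x} {C : Set 𝕄}

theorem IsMonster.aleph0_lt (h : IsMonster L 𝕄 κ) : ℵ₀ < κ := by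
  have h1 : ℵ₀ ≤ Cardinal.lift.{w} (Order.succ (theoryCard L)) := by
    rw [aleph0_le_lift]
    exact (le_max_left _ _).trans (Order.le_succ _)
  have := h1.trans_lt h.card_lt
  rwa [aleph0_lt_lift] at this

theorem IsMonster.card_union_lt (h : IsMonster L 𝕄 κ) {A B : Set 𝕄} (hA : #A < κ) (hB : #B < κ) :
    #(A ∪ B : Set 𝕄) < κ :=
  (mk_union_le A B).trans_lt (add_lt_of_lt h.aleph0_lt.le hA hB)

theorem IsMonster.card_finite_lt (h : IsMonster L 𝕄 κ) {A : Set 𝕄} (hA : A.Finite) : #A < κ :=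
  (lt_aleph0_iff_set_finite.2 hA).trans h.aleph0_lt

theorem IsMonster.exists_mem_sInter (h : IsMonster L 𝕄 κ) [Finite α] (hC : #C < κ)
    {F : Set (Set (α → 𝕄))} (hF : ∀ S ∈ F, C.Definable L S)
    (hfip : ∀ T : Finset (Set (α → 𝕄)), (T : Set (Set (α → 𝕄))) ⊆ F →
      (⋂₀ (T : Set (Set (α → 𝕄)))).Nonempty) : (⋂₀ F).Nonempty := by
  classical
  obtain ⟨n, ⟨e⟩⟩ := Finite.exists_equiv_fin α
  obtain ⟨a, ha⟩ := h.saturated C hC n {φ | {x : α → 𝕄 | φ.Realize (x ∘ e.symm)} ∈ F} (by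
    intro s hs
    obtain ⟨x, hx⟩ := hfip (s.image fun φ => {x : α → 𝕄 | φ.Realize (x ∘ e.symm)}) (by
      intro S hS
      obtain ⟨φ, hφ, rfl⟩ := Finset.mem_image.1 hS
      exact hs hφ)
    refine ⟨x ∘ e.symm, fun φ hφ => ?_⟩
    exact hx _ (Finset.mem_coe.2 (Finset.mem_image_of_mem _ hφ)))
  refine ⟨a ∘ e, fun S hS => ?_⟩
  obtain ⟨φ, hφ⟩ := hF S hS
  have hS' : S = {x : α → 𝕄 | (φ.relabel e).Realize (x ∘ e.symm)} := by
    rw [hφ]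
    ext x
    simp [Formula.realize_relabel, Function.comp_assoc]
  have := ha (φ.relabel e) (by rw [mem_ofPred_eq, ← hS']; exact hS)
  rw [hS', mem_ofPred_eq, Function.comp_assoc]
  simpa using this

theorem IsMonster.exists_equiv (h : IsMonster L 𝕄 κ) [Finite α] (hC : #C < κ) {a a' : α → 𝕄}
    (haa : SameType L C a a') :
    ∃ σ : 𝕄 ≃[L] 𝕄, (∀ c ∈ C, σ c = c) ∧ σ ∘ a = a' := by
  classical
  have key : ∀ c : ↥(C ∪ range a), ∃ i : C ⊕ α, Sum.elim (↑) a i = (c : 𝕄) := by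
    rintro ⟨c, hc | ⟨b, rfl⟩⟩
    · exact ⟨Sum.inl ⟨c, hc⟩, rfl⟩
    · exact ⟨Sum.inr b, rfl⟩
  choose g hg using key
  have hform : ∀ φ : L.Formula (C ⊕ α), φ.Realize (Sum.elim (↑) a) ↔ φ.Realize (Sum.elim (↑) a') := by
    intro φ
    exact sameType_iff_definable.1 haa {v | φ.Realize (Sum.elim (↑) v)}
      (definable_iff_exists_formula_sum.2 ⟨φ, rfl⟩)
  -- Equalities are formulas, so the map fixing `C` and taking `a` to `a'` does not depend on the
  -- names chosen by `g`.
  have heq : ∀ i j : C ⊕ α, (Sum.elim (↑) a i : 𝕄) = Sum.elim (↑) a j →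
      (Sum.elim (↑) a' i : 𝕄) = Sum.elim (↑) a' j := by
    intro i j hij
    have := hform (Term.equal (Term.var i) (Term.var j))
    simp only [Formula.realize_equal, Term.realize_var] at this
    exact this.1 hij
  obtain ⟨σ, hσ⟩ := h.homogeneous (C ∪ range a)
    (h.card_union_lt hC (h.card_finite_lt (finite_range a)))
    (fun c => Sum.elim (↑) a' (g c)) (by
      intro φ
      have := hform (φ.relabel g)
      rw [Formula.realize_relabel, Formula.realize_relabel] at this
      convert! this using 2
      ext c
      exact (hg c).symm)
  have hval : ∀ i : C ⊕ α, σ (Sum.elim (↑) a i) = Sum.elim (↑) a' i := by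
    intro i
    have hi : (Sum.elim (↑) a i : 𝕄) ∈ C ∪ range a := by
      rcases i with i | i
      · exact Or.inl i.2
      · exact Or.inr ⟨i, rfl⟩
    rw [hσ ⟨_, hi⟩]
    exact heq _ _ (hg ⟨_, hi⟩)
  refine ⟨σ, fun c hc => hval (Sum.inl ⟨c, hc⟩), ?_⟩
  ext i
  exact hval (Sum.inr i)

end Monster

/-! ### Global types as ultrafilters on tuples. -/

section GlobalTypes

variable {L : FirstOrder.Language.{u, v}} {𝕄 : Type w} [L.Structure 𝕄] {ι : Type w'}

/-- The global type `q` is the type of the ultrafilter `Q` on the tuples of the monster model. -/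
def IsTypeOfUltrafilter (q : GlobalType L 𝕄 ι) (Q : Ultrafilter (ι → 𝕄)) : Prop :=
  ∀ φ : L[[𝕄]].Formula ι, q.Contains φ ↔ ∀ᶠ x in (Q : Filter (ι → 𝕄)), φ.Realize x

/-- The formulas true of almost every tuple form a complete type: finitely many of them hold at a
common tuple. -/
theorem exists_isTypeOfUltrafilter_globalType [Nonempty 𝕄] (Q : Ultrafilter (ι → 𝕄)) :
    ∃ q : GlobalType L 𝕄 ι, IsTypeOfUltrafilter q Q := by
  classical
  let T : L[[𝕄]][[ι]].Theory :=
    {ψ | ∀ᶠ x in (Q : Filter (ι → 𝕄)), (Formula.equivSentence.symm ψ).Realize x}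
  refine ⟨⟨T, ?_, ?_, ?_⟩, ?_⟩
  · intro ψ hψ
    refine Eventually.of_forall fun x => ?_
    have : ψ ∈ (L.elementaryDiagram 𝕄).typeOf x := ((L.elementaryDiagram 𝕄).typeOf x).subset hψ
    exact Theory.CompleteType.mem_typeOf.1 this
  · rw [Theory.isSatisfiable_iff_isFinitelySatisfiable]
    intro T0 hT0
    have : ∀ᶠ x in (Q : Filter (ι → 𝕄)), ∀ ψ ∈ T0, (Formula.equivSentence.symm ψ).Realize x := by
      rw [Filter.eventually_all_finset]
      exact fun ψ hψ => hT0 hψ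
    obtain ⟨x, hx⟩ := this.exists
    refine ((L.elementaryDiagram 𝕄).typeOf x).isMaximal.1.mono fun ψ hψ => ?_
    exact Theory.CompleteType.mem_typeOf.2 (hx ψ hψ)
  · intro ψ
    rcases (Q.eventually_or (p := fun x => (Formula.equivSentence.symm ψ).Realize x)
      (q := fun x => ¬ (Formula.equivSentence.symm ψ).Realize x)).1
      (Eventually.of_forall fun x => em _) with h | h
    · exact Or.inl h
    · refine Or.inr (h.mono fun x hx => ?_)
      have : Formula.equivSentence.symm ψ.not = (Formula.equivSentence.symm ψ).not := by
        rw [Equiv.symm_apply_eq, Formula.equivSentence_not, Equiv.apply_symm_apply]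
      rw [this]
      exact hx
  · intro φ
    change (∀ᶠ x in (Q : Filter (ι → 𝕄)),
      (Formula.equivSentence.symm (Formula.equivSentence φ)).Realize x) ↔ _
    rw [Equiv.symm_apply_apply]

theorem GlobalType.contains_not (q : GlobalType L 𝕄 ι) (φ : L[[𝕄]].Formula ι) :
    q.Contains φ.not ↔ ¬ q.Contains φ := by
  unfold GlobalType.Contains
  rw [Formula.equivSentence_not]
  exact q.not_mem_iff _

/-- Otherwise the elementary diagram refutes the existential closure of the conjunction, while a
model of `q` satisfies it. -/
theorem GlobalType.exists_realize [Finite ι] [Nonempty 𝕄] (q : GlobalType L 𝕄 ι)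
    (s : Finset (L[[𝕄]].Formula ι)) (hs : ∀ φ ∈ s, q.Contains φ) :
    ∃ x : ι → 𝕄, ∀ φ ∈ s, φ.Realize x := by
  classical
  by_contra hcon
  push Not at hcon
  let θ : L[[𝕄]].Formula ι := BoundedFormula.iInf (β := s) fun φ => (φ : L[[𝕄]].Formula ι)
  have hθ : ∀ (N : Type (max u w v w')) [L[[𝕄]].Structure N] (x : ι → N),
      θ.Realize x ↔ ∀ φ : s, (φ : L[[𝕄]].Formula ι).Realize x := by
    intro N _ x
    simp only [θ, Formula.Realize, BoundedFormula.realize_iInf]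
  have hθ' : ∀ (x : ι → 𝕄), θ.Realize x ↔ ∀ φ : s, (φ : L[[𝕄]].Formula ι).Realize x := by
    intro x
    simp only [θ, Formula.Realize, BoundedFormula.realize_iInf]
  let τ : L[[𝕄]].Sentence :=
    (Formula.iExs ι (θ.relabel (Sum.inr : ι → Empty ⊕ ι)) : L[[𝕄]].Formula Empty)
  have hτ : τ.not ∈ L.elementaryDiagram 𝕄 := by
    change 𝕄 ⊨ τ.not
    rw [Sentence.realize_not]
    simp only [τ, Sentence.Realize, Formula.realize_iExs, Formula.realize_relabel]
    rintro ⟨x, hx⟩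
    obtain ⟨φ, hφ, hn⟩ := hcon x
    refine hn ((hθ' x).1 ?_ ⟨φ, hφ⟩)
    simpa using hx
  obtain ⟨N⟩ := q.isMaximal.1
  have h1 : N ⊨ (L[[𝕄]].lhomWithConstants ι).onSentence τ.not :=
    N.is_model.realize_of_mem _ (q.subset ⟨_, hτ, rfl⟩)
  let _ : L[[𝕄]].Structure N := (L[[𝕄]].lhomWithConstants ι).reduct N
  have : (L[[𝕄]].lhomWithConstants ι).IsExpansionOn N := LHom.isExpansionOn_reduct _ _
  rw [LHom.realize_onSentence, Sentence.realize_not] at h1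
  apply h1
  simp only [τ, Sentence.Realize, Formula.realize_iExs, Formula.realize_relabel]
  refine ⟨fun a => (L[[𝕄]].con a : N), ?_⟩
  have : θ.Realize (fun a => (L[[𝕄]].con a : N)) := by
    rw [hθ]
    intro φ
    rw [← Formula.realize_equivSentence]
    exact N.is_model.realize_of_mem _ (hs φ φ.2)
  simpa using this

theorem GlobalType.exists_isTypeOfUltrafilter [Finite ι] [Nonempty 𝕄] (q : GlobalType L 𝕄 ι) :
    ∃ Q : Ultrafilter (ι → 𝕄), IsTypeOfUltrafilter q Q := by
  classical
  obtain ⟨Q, hQ⟩ := Ultrafilter.exists_ultrafilter_of_finite_inter_nonempty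
    {S : Set (ι → 𝕄) | ∃ φ : L[[𝕄]].Formula ι, q.Contains φ ∧ S = Set.ofPred φ.Realize} (by
      intro T hT
      have hT' : ∀ S : T, ∃ φ : L[[𝕄]].Formula ι, q.Contains φ ∧ (S : Set (ι → 𝕄)) = Set.ofPred φ.Realize :=
        fun S => hT S.2
      choose f hf using hT'
      obtain ⟨x, hx⟩ := q.exists_realize (Finset.univ.image f) (by
        intro φ hφ
        obtain ⟨S, -, rfl⟩ := Finset.mem_image.1 hφ
        exact (hf S).1)
      refine ⟨x, fun S hS => ?_⟩
      change x ∈ ((⟨S, hS⟩ : T) : Set (ι → 𝕄))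
      rw [(hf ⟨S, hS⟩).2]
      exact hx _ (Finset.mem_image_of_mem _ (Finset.mem_univ _)))
  have hQ' : ∀ φ : L[[𝕄]].Formula ι, q.Contains φ →
      ∀ᶠ x in (Q : Filter (ι → 𝕄)), φ.Realize x := fun φ hφ => hQ ⟨φ, hφ, rfl⟩
  refine ⟨Q, fun φ => ⟨hQ' φ, fun h => ?_⟩⟩
  by_contra hn
  have := hQ' _ ((q.contains_not φ).2 hn)
  obtain ⟨x, hx, hx'⟩ := (h.and this).exists
  exact hx' hx

theorem realize_onFormula_lhomWithConstantsMap {A : Type x} {B : Type y} {N : Type w}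
    [L.Structure N] [(constantsOn A).Structure N] [(constantsOn B).Structure N] (f : A → B)
    [(LHom.constantsOnMap f).IsExpansionOn N] (φ : L[[A]].Formula ι) (x : ι → N) :
    ((L.lhomWithConstantsMap f).onFormula φ).Realize x ↔ φ.Realize x := by
  have : (L.lhomWithConstantsMap f).IsExpansionOn N := LHom.sumMap_isExpansionOn _ _ _
  exact LHom.realize_onFormula _ φ

theorem realize_onFormula_subtype_val {C : Set 𝕄} (φ : L[[C]].Formula ι) (x : ι → 𝕄) :
    ((L.lhomWithConstantsMap (Subtype.val : C → 𝕄)).onFormula φ).Realize x ↔ φ.Realize x := by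
  have : (LHom.constantsOnMap (Subtype.val : C → 𝕄)).IsExpansionOn 𝕄 :=
    constantsOnMap_isExpansionOn rfl
  exact realize_onFormula_lhomWithConstantsMap _ φ x

theorem realize_equiv_withConstants {N : Type w} [L.Structure N] [(constantsOn 𝕄).Structure N]
    (e : 𝕄 ≃[L] N) (he : ∀ c : 𝕄, ((L.con c : L[[𝕄]].Constants) : N) = e c)
    (φ : L[[𝕄]].Formula ι) (x : ι → 𝕄) : φ.Realize (e ∘ x) ↔ φ.Realize x := by
  let e' : 𝕄 ≃[L[[𝕄]]] N :=
    { e.toEquiv with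
      map_fun' := by
        intro n f x
        cases f with
        | inl f => exact e.map_fun' f x
        | inr c =>
          cases n with
          | zero =>
            rw [Subsingleton.elim (_ ∘ x) default, Subsingleton.elim x default]
            exact (he c).symm
          | succ n => exact isEmptyElim c
      map_rel' := by
        intro n R x
        cases R with
        | inl R => exact e.map_rel' R x
        | inr r => exact isEmptyElim r }
  exact StrongHomClass.realize_formula e' φ

/-- `σ` is an `L[[𝕄]]`-isomorphism from `𝕄`, where each constant names itself, onto `𝕄` with `c`
naming `σ c`. -/
theorem realize_onFormula_equiv (σ : 𝕄 ≃[L] 𝕄) (φ : L[[𝕄]].Formula ι) (x : ι → 𝕄) :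
    ((L.lhomWithConstantsMap σ).onFormula φ).Realize (σ ∘ x) ↔ φ.Realize x := by
  have h1 : @LHom.IsExpansionOn _ _ (LHom.constantsOnMap (σ : 𝕄 → 𝕄)) 𝕄
      (constantsOn.structure σ) constantsOnSelfStructure :=
    constantsOnMap_isExpansionOn rfl
  exact (@realize_onFormula_lhomWithConstantsMap L ι 𝕄 𝕄 𝕄 _ (constantsOn.structure σ) _ σ h1 φ
    (σ ∘ x)).trans
    (@realize_equiv_withConstants L 𝕄 _ ι 𝕄 _ (constantsOn.structure σ) σ (fun c => rfl) φ x)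

theorem IsTypeOfUltrafilter.realizesRestrict_iff {q : GlobalType L 𝕄 ι}
    {Q : Ultrafilter (ι → 𝕄)} (h : IsTypeOfUltrafilter q Q) {C : Set 𝕄} {a : ι → 𝕄} :
    q.RealizesRestrict C a ↔
      ∀ S : Set (ι → 𝕄), C.Definable L S → (∀ᶠ x in (Q : Filter (ι → 𝕄)), x ∈ S) → a ∈ S := by
  unfold GlobalType.RealizesRestrict
  simp only [h _, realize_onFormula_subtype_val]
  constructor
  · rintro h S ⟨φ, rfl⟩ hS
    exact h φ hS
  · intro h φ hφ
    exact h _ ⟨φ, rfl⟩ hφ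

theorem exists_formula_of_definable {C : Set 𝕄} {S : Set (ι → 𝕄)} (hS : C.Definable L S) :
    ∃ φ : L[[𝕄]].Formula ι, S = Set.ofPred φ.Realize := by
  obtain ⟨φ, rfl⟩ := hS
  refine ⟨(L.lhomWithConstantsMap (Subtype.val : C → 𝕄)).onFormula φ, ?_⟩
  ext x
  exact (realize_onFormula_subtype_val φ x).symm

/-- Invariance becomes the membership in `Q` of a family of sets, a form to which compactness
applies. -/
theorem IsTypeOfUltrafilter.isInvariant_iff {q : GlobalType L 𝕄 ι}
    {Q : Ultrafilter (ι → 𝕄)} (h : IsTypeOfUltrafilter q Q) {C : Set 𝕄} :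
    q.IsInvariant C ↔ ∀ σ : 𝕄 ≃[L] 𝕄, (∀ c ∈ C, σ c = c) → ∀ φ : L[[𝕄]].Formula ι,
      ∀ᶠ x in (Q : Filter (ι → 𝕄)), (φ.Realize x ↔ φ.Realize (σ.symm ∘ x)) := by
  have key : ∀ (σ : 𝕄 ≃[L] 𝕄) (φ : L[[𝕄]].Formula ι) (x : ι → 𝕄),
      ((L.lhomWithConstantsMap σ).onFormula φ).Realize x ↔ φ.Realize (σ.symm ∘ x) := by
    intro σ φ x
    rw [← realize_onFormula_equiv σ φ]
    have : σ ∘ (σ.symm ∘ x) = x := by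
      ext i
      simp
    rw [this]
  have hiff : ∀ P R : (ι → 𝕄) → Prop, ((∀ᶠ x in (Q : Filter (ι → 𝕄)), P x) ↔
      ∀ᶠ x in (Q : Filter (ι → 𝕄)), R x) ↔ ∀ᶠ x in (Q : Filter (ι → 𝕄)), (P x ↔ R x) := by
    intro P R
    constructor
    · intro hPR
      by_cases hP : ∀ᶠ x in (Q : Filter (ι → 𝕄)), P x
      · filter_upwards [hP, hPR.1 hP] with x h1 h2
        exact iff_of_true h1 h2
      · have hR := mt hPR.2 hP
        rw [← Ultrafilter.eventually_not] at hP hR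
        filter_upwards [hP, hR] with x h1 h2
        exact iff_of_false h1 h2
    · exact fun hPR => eventually_congr hPR
  unfold GlobalType.IsInvariant
  simp only [h _, key, hiff]

end GlobalTypes

/-! ### Homogeneous subsequences of long well-orders. -/

section ErdosRado

/-- The elements of an end-homogeneous sequence leading up to `α`, chosen minimal at each step. -/
theorem exists_endHomogeneous_path {n : ℕ} {C K J : Type w} [LinearOrder K] [WellFoundedLT K]
    [LinearOrder J] [WellFoundedLT J] (f : (Fin (n + 1) → J) → C) (α : J) :
    ∃ e : K → J, ∀ k, IsLeast {γ | ((∀ k' < k, e k' < γ) ∧ ∀ u : Fin n → K, (∀ i, u i < k) →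
      f (Fin.snoc (e ∘ u) γ) = f (Fin.snoc (e ∘ u) α)) ∨ γ = α} (e k) := by
  let Γ : (k : K) → ((k' : K) → k' < k → J) → Set J := fun k rec =>
    {γ | ((∀ k' (h : k' < k), rec k' h < γ) ∧ ∀ (u : Fin n → K) (hu : ∀ i, u i < k),
      f (Fin.snoc (fun i => rec (u i) (hu i)) γ) = f (Fin.snoc (fun i => rec (u i) (hu i)) α)) ∨
      γ = α}
  have hne : ∀ k rec, (Γ k rec).Nonempty := fun k rec => ⟨α, Or.inr rfl⟩
  have wfK : WellFounded ((· < ·) : K → K → Prop) := wellFounded_lt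
  have wfJ : WellFounded ((· < ·) : J → J → Prop) := wellFounded_lt
  let e : K → J := wfK.fix fun k rec => wfJ.min (Γ k rec) (hne k rec)
  have he : ∀ k, e k = wfJ.min (Γ k fun k' _ => e k') (hne k _) := fun k => wfK.fix_eq _ k
  refine ⟨e, fun k => ?_⟩
  have h1 : e k ∈ Γ k fun k' _ => e k' := by
    have := wfJ.min_mem (Γ k fun k' _ => e k') (hne k _)
    rwa [← he k] at this
  refine ⟨h1, fun γ hγ => ?_⟩
  rw [he k]
  exact not_lt.1 (wfJ.not_lt_min _ hγ)

/-- Each `α` has a path leading towards it. A path that never reaches its `α` is end-homogeneous. If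
every `α` were reached, it would be determined by the stage at which this happens and the colours it
induces, and `J` has more elements than there are such codes. -/
theorem exists_endHomogeneous (n : ℕ) (C K : Type w) [LinearOrder K] [WellFoundedLT K] :
    ∃ (J : Type w) (_ : LinearOrder J) (_ : WellFoundedLT J), ∀ f : (Fin (n + 1) → J) → C,
      ∃ h : K → J, StrictMono h ∧ ∃ g : (Fin n → K) → C, ∀ (u : Fin n → K) (k : K),
        (∀ i, u i < k) → f (Fin.snoc (h ∘ u) (h k)) = g u := by
  classical
  let c : Cardinal.{w} := Order.succ #(K × ((Fin n → K) → C))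
  refine ⟨c.ord.ToType, inferInstance, inferInstance, fun f => ?_⟩
  choose e he using exists_endHomogeneous_path (K := K) f
  by_cases hα : ∃ α, ∀ k, e α k ≠ α
  · obtain ⟨α, hα⟩ := hα
    have h1 := fun k => (he α k).1.resolve_right (hα k)
    exact ⟨e α, fun k' k hk => (h1 k).1 k' hk, fun u => f (Fin.snoc (e α ∘ u) α),
      fun u k hu => (h1 k).2 u hu⟩
  · exfalso
    push Not at hα
    have wfK : WellFounded ((· < ·) : K → K → Prop) := wellFounded_lt
    let s : c.ord.ToType → Set K := fun α => {k | e α k = α}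
    let k₀ : c.ord.ToType → K := fun α => wfK.min (s α) (hα α)
    have hk₀ : ∀ α, e α (k₀ α) = α := fun α => wfK.min_mem (s α) (hα α)
    have hlt : ∀ α, ∀ k < k₀ α, e α k ≠ α := fun α k hk h => wfK.not_lt_min (s α) h hk
    have hadm : ∀ α, ∀ k ≤ k₀ α, (∀ k' < k, e α k' < e α k) ∧ ∀ u : Fin n → K, (∀ i, u i < k) →
        f (Fin.snoc (e α ∘ u) (e α k)) = f (Fin.snoc (e α ∘ u) α) := by
      intro α k hk
      rcases hk.lt_or_eq with hk | rfl
      · exact (he α k).1.resolve_right (hlt α k hk)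
      · rw [hk₀]
        refine ⟨fun k' hk' => ?_, fun _ _ => rfl⟩
        exact lt_of_le_of_ne ((he α k').2 (Or.inr rfl)) (hlt α k' hk')
    let code : c.ord.ToType → K × ((Fin n → K) → C) := fun α =>
      (k₀ α, fun u => f (Fin.snoc (e α ∘ u) α))
    have hinj : Function.Injective code := by
      -- With equal codes, each value of one path is a candidate for the other, and both paths
      -- choose least candidates.
      have main : ∀ α α', code α = code α' → ∀ k ≤ k₀ α, e α k = e α' k := by
        intro α α' hc k
        have hk : k₀ α = k₀ α' := congrArg Prod.fst hc
        have hcf : ∀ u : Fin n → K, f (Fin.snoc (e α ∘ u) α) = f (Fin.snoc (e α' ∘ u) α') :=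
          fun u => congrFun (congrArg Prod.snd hc) u
        induction k using wfK.induction with
        | _ k ih =>
          intro hkk
          have hcomp : ∀ u : Fin n → K, (∀ i, u i < k) → e α ∘ u = e α' ∘ u := fun u hu =>
            funext fun i => ih _ (hu i) ((hu i).le.trans hkk)
          apply le_antisymm
          · refine (he α k).2 (Or.inl ?_)
            obtain ⟨h1, h2⟩ := hadm α' k (hk ▸ hkk)
            refine ⟨fun k' hk' => ?_, fun u hu => ?_⟩
            · rw [ih k' hk' (hk'.le.trans hkk)]
              exact h1 k' hk'
            · rw [hcf, hcomp u hu]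
              exact h2 u hu
          · refine (he α' k).2 (Or.inl ?_)
            obtain ⟨h1, h2⟩ := hadm α k hkk
            refine ⟨fun k' hk' => ?_, fun u hu => ?_⟩
            · rw [← ih k' hk' (hk'.le.trans hkk)]
              exact h1 k' hk'
            · rw [← hcf, ← hcomp u hu]
              exact h2 u hu
      intro α α' hc
      have h1 := main α α' hc (k₀ α) le_rfl
      have hk : k₀ α = k₀ α' := congrArg Prod.fst hc
      rw [hk₀ α, hk, hk₀ α'] at h1
      exact h1
    have := mk_le_of_injective hinj
    rw [mk_ord_toType] at this
    exact (Order.lt_succ _).not_ge this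

/-- A form of the Erdős–Rado theorem without bounds. -/
theorem exists_homogeneous (n : ℕ) (C : Type w) : ∀ (K : Type w) [LinearOrder K] [WellFoundedLT K],
    ∃ (J : Type w) (_ : LinearOrder J) (_ : WellFoundedLT J), ∀ f : (Fin n → J) → C,
      ∃ h : K → J, StrictMono h ∧ ∃ c : C, ∀ u : Fin n → K, StrictMono u → f (h ∘ u) = c := by
  induction n with
  | zero =>
    intro K _ _
    refine ⟨K, inferInstance, inferInstance, fun f => ⟨id, strictMono_id, f finZeroElim, ?_⟩⟩
    intro u _
    exact congrArg f (Subsingleton.elim _ _)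
  | succ n ih =>
    intro K _ _
    -- Along an end-homogeneous copy of `J₁` the last entry does not affect the colour, which leaves
    -- an `n`-ary colouring.
    obtain ⟨J₁, _, _, h₁⟩ := ih K
    obtain ⟨J, i, j, hJ⟩ := exists_endHomogeneous n C J₁
    refine ⟨J, i, j, fun f => ?_⟩
    obtain ⟨h, hmono, g, hg⟩ := hJ f
    obtain ⟨h', hmono', c, hc⟩ := h₁ g
    refine ⟨h ∘ h', hmono.comp hmono', c, fun u hu => ?_⟩
    have h2 : (h ∘ h') ∘ u = Fin.snoc (h ∘ (h' ∘ (u ∘ Fin.castSucc))) (h (h' (u (Fin.last n)))) := by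
      ext i
      refine Fin.lastCases ?_ (fun i => ?_) i <;> simp
    rw [h2, hg _ _ fun i => ?_]
    · exact hc _ (hu.comp Fin.strictMono_castSucc)
    · exact hmono' (hu (Fin.castSucc_lt_last i))

end ErdosRado

/-! ### Types of finite subtuples of a generic sequence. -/

section UltrafilterTypes

variable (L : FirstOrder.Language.{u, v}) {𝕄 : Type w} [L.Structure 𝕄] (D : Set 𝕄)
  {ι : Type} {J : Type x} {β : Type y}

/-- The concatenation of the tuples `v (u p)`. -/
def tup (v : J → ι → 𝕄) (u : β → J) : β × ι → 𝕄 := fun p => v (u p.1) p.2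

/-- The type over `D`, as a set of definable sets, of the subtuple at the indices `u`
of a generic element of the ultrafilter `U`. -/
def utype (U : Ultrafilter (J → ι → 𝕄)) (u : β → J) : Set (Set (β × ι → 𝕄)) :=
  {S | D.Definable L S ∧ ∀ᶠ v in (U : Filter (J → ι → 𝕄)), tup v u ∈ S}

variable {L D} {U U' : Ultrafilter (J → ι → 𝕄)} {u : β → J}

theorem utype_compl_of_notMem {S : Set (β × ι → 𝕄)} (hS : D.Definable L S)
    (h : S ∉ utype L D U u) : Sᶜ ∈ utype L D U u := by
  refine ⟨hS.compl, ?_⟩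
  have : ¬ ∀ᶠ v in (U : Filter (J → ι → 𝕄)), tup v u ∈ S := fun h' => h ⟨hS, h'⟩
  rwa [← Ultrafilter.eventually_not] at this

theorem mem_iff_mem_utype {x : β × ι → 𝕄} (hx : x ∈ ⋂₀ utype L D U u) {S : Set (β × ι → 𝕄)}
    (hS : D.Definable L S) : x ∈ S ↔ S ∈ utype L D U u := by
  refine ⟨fun h => ?_, fun h => hx S h⟩
  by_contra hn
  exact hx _ (utype_compl_of_notMem hS hn) h

theorem utype_eq_of_subset (h : utype L D U u ⊆ utype L D U' u) :
    utype L D U u = utype L D U' u := by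
  refine h.antisymm fun S hS => ?_
  by_contra hn
  have h1 := h (utype_compl_of_notMem hS.1 hn)
  obtain ⟨v, hv, hv'⟩ := (hS.2.and h1.2).exists
  exact hv' hv

theorem sameType_of_mem_utype {x x' : β × ι → 𝕄} (hx : x ∈ ⋂₀ utype L D U u)
    (hx' : x' ∈ ⋂₀ utype L D U u) : SameType L D x x' :=
  sameType_iff_definable.2 fun _ hS =>
    (mem_iff_mem_utype hx hS).trans (mem_iff_mem_utype hx' hS).symm

theorem mem_utype_of_sameType {x x' : β × ι → 𝕄} (hx : x ∈ ⋂₀ utype L D U u)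
    (h : SameType L D x x') : x' ∈ ⋂₀ utype L D U u :=
  fun S hS => (sameType_iff_definable.1 h S hS.1).1 (hx S hS)

theorem comp_mem_utype {γ : Type*} {x : β × ι → 𝕄} (hx : x ∈ ⋂₀ utype L D U u) (f : γ → β) :
    x ∘ Prod.map f id ∈ ⋂₀ utype L D U (u ∘ f) := by
  intro S hS
  exact hx _ ⟨hS.1.preimage_comp (Prod.map f id), hS.2⟩

theorem exists_mem_utype {κ : Cardinal.{w}} (h : IsMonster L 𝕄 κ) (hD : #D < κ) [Finite ι]
    [Finite β] (U : Ultrafilter (J → ι → 𝕄)) (u : β → J) : (⋂₀ utype L D U u).Nonempty := by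
  refine h.exists_mem_sInter hD (fun S hS => hS.1) fun T hT => ?_
  have : ∀ᶠ v in (U : Filter (J → ι → 𝕄)), ∀ S ∈ T, tup v u ∈ S := by
    rw [Filter.eventually_all_finset]
    exact fun S hS => (hT hS).2
  obtain ⟨v, hv⟩ := this.exists
  exact ⟨tup v u, fun S hS => hv S hS⟩

theorem utype_map {K : Type*} (h : K → J) (u : β → K) :
    utype L D (U.map fun v => v ∘ h) u = utype L D U (h ∘ u) := rfl

end UltrafilterTypes

/-! ### Free sequences along arbitrary well-orders. -/

section FreeSequences

variable (L : FirstOrder.Language.{u, v}) {𝕄 : Type w} [L.Structure 𝕄] (D : Set 𝕄)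
  {ι : Type}

/-- A relation of freeness between tuples and finite sets which is invariant over `D`, monotone, has
strong finite character and right extension. -/
structure IsFreeness (R : (ι → 𝕄) → Set 𝕄 → Prop) : Prop where
  invariant : ∀ σ : 𝕄 ≃[L] 𝕄, (∀ c ∈ D, σ c = c) → ∀ b B, B.Finite → R b B → R (σ ∘ b) (σ '' B)
  mono : ∀ b B B', B.Finite → R b B → B' ⊆ B → R b B'
  strongFiniteCharacter : ∀ b B, B.Finite → ¬ R b B →
    ∃ S, (D ∪ B).Definable L S ∧ b ∈ S ∧ ∀ b' ∈ S, ¬ R b' B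
  extension : ∀ b B B', B'.Finite → R b B → B ⊆ B' → ∃ b', SameType L (D ∪ B) b b' ∧ R b' B'

variable {L D} {R : (ι → 𝕄) → Set 𝕄 → Prop} {b : ι → 𝕄} {J : Type x}

variable (R) in
/-- The last tuple is free from the previous ones. -/
def LastFree {n : ℕ} (x : Fin (n + 1) × ι → 𝕄) : Prop :=
  R (fun i => x (Fin.last n, i)) (range (x ∘ Prod.map Fin.castSucc id))

variable (L D R b) in
/-- In a generic element of `U`, the tuples with indices in `I` have the type of `b` over `D`, and
each is free from the previous ones. -/
structure IsFreeOn [LinearOrder J] (U : Ultrafilter (J → ι → 𝕄)) (I : Set J) : Prop where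
  free : ∀ (n : ℕ) (u : Fin (n + 1) → J), StrictMono u → (∀ i, u i ∈ I) →
    ∀ x ∈ ⋂₀ utype L D U u, LastFree R x
  base : ∀ j ∈ I, ∀ S : Set (ι → 𝕄), D.Definable L S → b ∈ S →
    ∀ᶠ v in (U : Filter (J → ι → 𝕄)), v j ∈ S

theorem IsFreeOn.congr [LinearOrder J] {U U' : Ultrafilter (J → ι → 𝕄)} {I : Set J}
    (h : IsFreeOn L D R b U I)
    (hUU : ∀ (n : ℕ) (u : Fin n → J), (∀ i, u i ∈ I) → utype L D U u = utype L D U' u) :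
    IsFreeOn L D R b U' I := by
  refine ⟨fun n u hu huI x hx => h.free n u hu huI x (by rwa [hUU _ u huI]), ?_⟩
  intro j hj S hS hb
  have h1 : {x : Fin 1 × ι → 𝕄 | (fun i => x (0, i)) ∈ S} ∈ utype L D U (fun _ : Fin 1 => j) :=
    ⟨hS.preimage_comp fun i => ((0 : Fin 1), i), h.base j hj S hS hb⟩
  rw [hUU 1 _ fun _ => hj] at h1
  exact h1.2

/-- Dependence of the last tuple is forced by a set over `D` and the previous tuples. Read over `D`
in both groups of variables, this set `X` forces dependence from every conjugate of the previous
tuples, by homogeneity. Freeness thus reduces to omitting such `X`, which an ultrafilter can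
express. -/
theorem lastFree_of_forall_forcing {κ : Cardinal.{w}} (h : IsMonster L 𝕄 κ) (hD : #D < κ)
    [Finite ι] (hR : IsFreeness L D R) {n : ℕ} {x : Fin (n + 1) × ι → 𝕄}
    (hx : ∀ X : Set (ι ⊕ (Fin n × ι) → 𝕄), D.Definable L X →
      (∀ x', SameType L D (x ∘ Prod.map Fin.castSucc id) x' → ∀ b', Sum.elim b' x' ∈ X →
        ¬ R b' (range x')) →
      Sum.elim (fun i => x (Fin.last n, i)) (x ∘ Prod.map Fin.castSucc id) ∉ X) :
    LastFree R x := by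
  by_contra hn
  obtain ⟨S, hS, hxS, hforce⟩ := hR.strongFiniteCharacter _ _ (finite_range _) hn
  obtain ⟨X, hX, rfl⟩ := exists_definable_fiber hS
  refine hx X hX ?_ hxS
  intro x' hx' b' hb' hRb
  obtain ⟨σ, hσ, rfl⟩ := h.exists_equiv hD hx'
  have hσ' : ∀ c ∈ D, σ.symm c = c := fun c hc => by
    conv_lhs => rw [← hσ c hc]
    simp
  refine hforce (σ.symm ∘ b') ?_ ?_
  · rw [mem_ofPred_eq, ← mem_definable_equiv_iff hX σ hσ]
    convert! hb' using 1
    ext i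
    rcases i with i | i <;> simp
  · have := hR.invariant σ.symm hσ' _ _ (finite_range _) hRb
    convert! this using 1
    rw [← range_comp]
    congr 1
    ext i
    simp

/-- One more tuple can be made free from the previous ones. -/
theorem IsFreeOn.exists_extension {κ : Cardinal.{w}} (h : IsMonster L 𝕄 κ) (hD : #D < κ)
    [Finite ι] (hR : IsFreeness L D R) (hb : R b ∅) [LinearOrder J]
    {U : Ultrafilter (J → ι → 𝕄)} {I : Set J} (hU : IsFreeOn L D R b U I) {j : J}
    (hI : ∀ i, i ∈ I ↔ i < j) :
    ∃ U' : Ultrafilter (J → ι → 𝕄), IsFreeOn L D R b U' (insert j I) ∧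
      ∀ (n : ℕ) (u : Fin n → J), (∀ i, u i ∈ I) → utype L D U u = utype L D U' u := by
  classical
  -- `F₁` keeps the types fixed on `I`, `F₂` puts the type of `b` at `j`, and `F₃` omits the sets
  -- that force the tuple at `j` to depend on earlier ones.
  let F₁ : Set (Set (J → ι → 𝕄)) := {s | ∃ (n : ℕ) (u : Fin n → J) (S : Set (Fin n × ι → 𝕄)),
    (∀ i, u i ∈ I) ∧ S ∈ utype L D U u ∧ s = {v | tup v u ∈ S}}
  let F₂ : Set (Set (J → ι → 𝕄)) := {s | ∃ S : Set (ι → 𝕄), D.Definable L S ∧ b ∈ S ∧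
    s = {v | v j ∈ S}}
  let F₃ : Set (Set (J → ι → 𝕄)) := {s | ∃ (n : ℕ) (u : Fin n → J)
    (X : Set (ι ⊕ (Fin n × ι) → 𝕄)), (∀ i, u i ∈ I) ∧ (∀ x ∈ ⋂₀ utype L D U u, ∀ b',
      Sum.elim b' x ∈ X → ¬ R b' (range x)) ∧ s = {v | Sum.elim (v j) (tup v u) ∉ X}}
  let P : (J → ι → 𝕄) → Finset J → Prop := fun v G =>
    (∀ (n : ℕ) (u : Fin n → J), (∀ i, u i ∈ G) → tup v u ∈ ⋂₀ utype L D U u) ∧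
      SameType L D b (v j) ∧ R (v j) (⋃ i ∈ G, range (v i))
  have hPmono : ∀ v G G', G' ⊆ G → P v G → P v G' := by
    intro v G G' hG hP
    refine ⟨fun n u hu => hP.1 n u fun i => hG (hu i), hP.2.1, ?_⟩
    exact hR.mono _ _ _ (G.finite_toSet.biUnion fun i _ => finite_range _) hP.2.2
      (biUnion_subset_biUnion_left fun i hi => hG hi)
  have hsupp : ∀ s ∈ F₁ ∪ F₂ ∪ F₃, ∃ G : Finset J, (∀ i ∈ G, i ∈ I) ∧ ∀ v, P v G → v ∈ s := by
    rintro s ((⟨n, u, S, hu, hS, rfl⟩ | ⟨S, hS, hbS, rfl⟩) | ⟨n, u, X, hu, hX, rfl⟩)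
    · refine ⟨Finset.univ.image u, by simpa using hu, fun v hv => ?_⟩
      exact hv.1 n u (fun i => by simp) S hS
    · exact ⟨∅, by simp, fun v hv => (sameType_iff_definable.1 hv.2.1 S hS).1 hbS⟩
    · refine ⟨Finset.univ.image u, by simpa using hu, fun v hv hvX => ?_⟩
      refine hX _ (hv.1 n u (fun i => by simp)) _ hvX ?_
      refine hR.mono _ _ _ ((Finset.finite_toSet _).biUnion fun i _ => finite_range _) hv.2.2 ?_
      rintro _ ⟨p, rfl⟩
      refine mem_biUnion (x := u p.1) (by simp) ⟨p.2, rfl⟩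
  -- Realise the type at the indices in `G`, then take a copy of `b` that is free from this
  -- realisation.
  have hP : ∀ G : Finset J, (∀ i ∈ G, i ∈ I) → ∃ v, P v G := by
    intro G hG
    obtain ⟨x, hx⟩ := exists_mem_utype h hD U (fun i : G => (i : J))
    obtain ⟨b', hb', hRb'⟩ := hR.extension b ∅ (range x) (finite_range x) hb (empty_subset _)
    let v : J → ι → 𝕄 := fun i k => if hi : i ∈ G then x (⟨i, hi⟩, k) else b' k
    have hvj : v j = b' := by
      ext k
      have : j ∉ G := fun hj => lt_irrefl j ((hI j).1 (hG j hj))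
      simp [v, this]
    refine ⟨v, fun n u hu => ?_, ?_, ?_⟩
    · have := comp_mem_utype hx fun i : Fin n => (⟨u i, hu i⟩ : G)
      convert! this using 1
      ext p
      simp [tup, v, hu, Prod.map]
    · rw [hvj]
      exact hb'.mono subset_union_left
    · rw [hvj]
      refine hR.mono _ _ _ (finite_range x) hRb' ?_
      refine iUnion₂_subset fun i hi => ?_
      rintro _ ⟨k, rfl⟩
      exact ⟨(⟨i, hi⟩, k), by simp [v, hi]⟩
  obtain ⟨U', hU'⟩ := Ultrafilter.exists_ultrafilter_of_finite_inter_nonempty (F₁ ∪ F₂ ∪ F₃) (by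
    intro T hT
    choose! G hG using hsupp
    obtain ⟨v, hv⟩ := hP (T.biUnion G) (by
      intro i hi
      obtain ⟨s, hs, hi⟩ := Finset.mem_biUnion.1 hi
      exact (hG s (hT hs)).1 i hi)
    exact ⟨v, fun s hs => (hG s (hT hs)).2 v
      (hPmono _ _ _ (Finset.subset_biUnion_of_mem G hs) hv)⟩)
  have hagree : ∀ (n : ℕ) (u : Fin n → J), (∀ i, u i ∈ I) → utype L D U u = utype L D U' u := by
    intro n u hu
    exact utype_eq_of_subset fun S hS => ⟨hS.1, hU' (Or.inl (Or.inl ⟨n, u, S, hu, hS, rfl⟩))⟩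
  have hUI := hU.congr hagree
  refine ⟨U', ⟨?_, ?_⟩, hagree⟩
  · intro n u hu huI x hx
    by_cases hlast : u (Fin.last n) ∈ I
    · refine hUI.free n u hu (fun i => ?_) x hx
      rw [hI] at hlast ⊢
      exact (hu.monotone (Fin.le_last i)).trans_lt hlast
    have hlast : u (Fin.last n) = j := (huI _).resolve_right hlast
    have hinit : ∀ i : Fin n, (u ∘ Fin.castSucc) i ∈ I := by
      intro i
      rw [hI, ← hlast]
      exact hu (Fin.castSucc_lt_last i)
    refine lastFree_of_forall_forcing h hD hR fun X hX hforce hxX => ?_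
    have hx' := comp_mem_utype hx Fin.castSucc
    rw [← hagree n _ hinit] at hx'
    have h1 : ∀ᶠ v in (U' : Filter (J → ι → 𝕄)), Sum.elim (v j) (tup v (u ∘ Fin.castSucc)) ∉ X :=
      hU' (Or.inr ⟨n, u ∘ Fin.castSucc, X, hinit,
        fun y hy => hforce y (sameType_of_mem_utype hx' hy), rfl⟩)
    let g : ι ⊕ (Fin n × ι) → Fin (n + 1) × ι :=
      Sum.elim (fun i => (Fin.last n, i)) (Prod.map Fin.castSucc id)
    have h2 : ((fun y : Fin (n + 1) × ι → 𝕄 => y ∘ g) ⁻¹' Xᶜ) ∈ utype L D U' u := by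
      refine ⟨hX.compl.preimage_comp g, h1.mono fun v hv => ?_⟩
      have : tup v u ∘ g = Sum.elim (v j) (tup v (u ∘ Fin.castSucc)) := by
        ext i
        rcases i with i | i
        · simp [g, tup, hlast]
        · simp [g, tup]
      change tup v u ∘ g ∈ Xᶜ
      rw [this]
      exact hv
    have h3 := hx _ h2
    apply h3
    convert! hxX using 1
    ext i
    rcases i with i | i <;> simp [g]
  · rintro i (rfl | hi) S hS hbS
    · exact hU' (Or.inl (Or.inr ⟨S, hS, hbS, rfl⟩))
    · exact hUI.base i hi S hS hbS

/-- Free sequences of tuples exist, as ultrafilters, for every well-ordered index set. -/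
theorem exists_isFreeOn_univ {κ : Cardinal.{w}} (h : IsMonster L 𝕄 κ) (hD : #D < κ)
    [Finite ι] (hR : IsFreeness L D R) (hb : R b ∅) (J : Type x) [LinearOrder J]
    [WellFoundedLT J] : ∃ U : Ultrafilter (J → ι → 𝕄), IsFreeOn L D R b U Set.univ := by
  classical
  let Z := {p : Set J × Ultrafilter (J → ι → 𝕄) // IsLowerSet p.1 ∧ IsFreeOn L D R b p.2 p.1}
  -- The relation compares types of finite subtuples, not the ultrafilters themselves; this is what
  -- an upper bound of a chain can preserve.
  let r : Z → Z → Prop := fun p q => p.1.1 ⊆ q.1.1 ∧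
    ∀ (n : ℕ) (u : Fin n → J), (∀ i, u i ∈ p.1.1) → utype L D p.1.2 u = utype L D q.1.2 u
  have hrtrans : ∀ {p q s : Z}, r p q → r q s → r p s := fun hpq hqs =>
    ⟨hpq.1.trans hqs.1, fun n u hu => (hpq.2 n u hu).trans (hqs.2 n u fun i => hpq.1 (hu i))⟩
  obtain ⟨m, hm⟩ := exists_maximal_of_chains_bounded (r := r) (by
    intro c hc
    rcases c.eq_empty_or_nonempty with rfl | hne
    · refine ⟨⟨(∅, (pure fun _ => b : Ultrafilter (J → ι → 𝕄))), isLowerSet_empty,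
        fun n u _ hu => (hu 0).elim, fun j hj => hj.elim⟩, by simp⟩
    let F : Z → Set (Set (J → ι → 𝕄)) := fun p => {s | ∃ (n : ℕ) (u : Fin n → J)
      (S : Set (Fin n × ι → 𝕄)), (∀ i, u i ∈ p.1.1) ∧ S ∈ utype L D p.1.2 u ∧
      s = {v | tup v u ∈ S}}
    have hFmono : ∀ p q, r p q → F p ⊆ F q := by
      rintro p q hpq s ⟨n, u, S, hu, hS, rfl⟩
      exact ⟨n, u, S, fun i => hpq.1 (hu i), hpq.2 n u hu ▸ hS, rfl⟩
    have hdir : DirectedOn (fun p q => F p ⊆ F q) c := by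
      intro p hp q hq
      by_cases hpq : p = q
      · exact ⟨p, hp, subset_rfl, hpq ▸ subset_rfl⟩
      · rcases hc hp hq hpq with hr | hr
        · exact ⟨q, hq, hFmono _ _ hr, subset_rfl⟩
        · exact ⟨p, hp, subset_rfl, hFmono _ _ hr⟩
    obtain ⟨U, hU⟩ := Ultrafilter.exists_ultrafilter_of_finite_inter_nonempty (⋃ p ∈ c, F p) (by
      intro T hT
      obtain ⟨p, hp, hTp⟩ := DirectedOn.exists_mem_subset_of_finset_subset_biUnion hne hdir hT
      have : ∀ᶠ v in (p.1.2 : Filter (J → ι → 𝕄)), ∀ s ∈ T, v ∈ s := by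
        rw [Filter.eventually_all_finset]
        intro s hs
        obtain ⟨n, u, S, hu, hS, rfl⟩ := hTp hs
        exact hS.2
      obtain ⟨v, hv⟩ := this.exists
      exact ⟨v, fun s hs => hv s hs⟩)
    have hagree : ∀ p ∈ c, ∀ (n : ℕ) (u : Fin n → J), (∀ i, u i ∈ p.1.1) →
        utype L D p.1.2 u = utype L D U u := by
      intro p hp n u hu
      exact utype_eq_of_subset fun S hS =>
        ⟨hS.1, hU (mem_biUnion hp ⟨n, u, S, hu, hS, rfl⟩)⟩
    have hfree : ∀ p ∈ c, IsFreeOn L D R b U p.1.1 := fun p hp => p.2.2.congr (hagree p hp)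
    refine ⟨⟨(⋃ p ∈ c, p.1.1, U), isLowerSet_iUnion₂ fun p _ => p.2.1, ?_, ?_⟩, ?_⟩
    · intro n u hu huI
      obtain ⟨p, hp, hlast⟩ := mem_iUnion₂.1 (huI (Fin.last n))
      exact (hfree p hp).free n u hu fun i => p.2.1 (hu.monotone (Fin.le_last i)) hlast
    · intro j hj
      obtain ⟨p, hp, hj⟩ := mem_iUnion₂.1 hj
      exact (hfree p hp).base j hj
    · exact fun p hp => ⟨subset_biUnion_of_mem (u := fun p : Z => p.1.1) hp, hagree p hp⟩) hrtrans
  obtain ⟨⟨I, U⟩, hI, hU⟩ := m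
  have hIuniv : I = Set.univ := by
    by_contra hne
    have hne' : (Iᶜ).Nonempty := nonempty_compl.2 hne
    have wf : WellFounded ((· < ·) : J → J → Prop) := wellFounded_lt
    have hj := wf.min_mem Iᶜ hne'
    have hlt : ∀ i, i ∈ I ↔ i < wf.min Iᶜ hne' := by
      intro i
      constructor
      · intro hi
        by_contra hn
        exact hj (hI (not_lt.1 hn) hi)
      · intro hi
        by_contra hn
        exact wf.not_lt_min Iᶜ hn hi
    obtain ⟨U', hU', hagree⟩ := hU.exists_extension h hD hR hb hlt
    have hlow : IsLowerSet (insert (wf.min Iᶜ hne') I) := by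
      rintro a c hca (rfl | ha)
      · rcases hca.lt_or_eq with hc | rfl
        · exact Or.inr ((hlt c).2 hc)
        · exact Or.inl rfl
      · exact Or.inr (hI hca ha)
    have := hm ⟨(insert (wf.min Iᶜ hne') I, U'), hlow, hU'⟩ ⟨subset_insert _ _, hagree⟩
    exact hj (this.1 (mem_insert _ _))
  subst hIuniv
  exact ⟨U, hU⟩

end FreeSequences

/-! ### Dependent choice. -/

section Choice

/-- Dependent choice for a property of the first `n + 1` terms of a sequence. -/
theorem exists_forall_of_update {X : ℕ → Type x} {P : ℕ → (∀ k, X k) → Prop} (h0 : ∃ f, P 0 f)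
    (hsucc : ∀ n f, P n f → ∃ y, P (n + 1) (Function.update f (n + 1) y))
    (hcongr : ∀ n f g, (∀ k ≤ n, f k = g k) → P n f → P n g) : ∃ f, ∀ n, P n f := by
  obtain ⟨f₀, hf₀⟩ := h0
  have : ∀ k, Nonempty (X k) := fun k => ⟨f₀ k⟩
  choose! y hy using hsucc
  let p : ℕ → ∀ k, X k := fun n => Nat.rec f₀ (fun n f => Function.update f (n + 1) (y n f)) n
  have hp : ∀ n, P n (p n) := by
    intro n
    induction n with
    | zero => exact hf₀
    | succ n ih => exact hy n _ ih
  have hagree : ∀ n, ∀ k ≤ n, p n k = p k k := by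
    intro n
    induction n with
    | zero =>
      intro k hk
      obtain rfl := Nat.le_zero.1 hk
      rfl
    | succ n ih =>
      intro k hk
      rcases hk.lt_or_eq with hk | rfl
      · exact (Function.update_of_ne hk.ne _ _).trans (ih k (Nat.lt_succ_iff.1 hk))
      · rfl
  exact ⟨fun k => p k k, fun n => hcongr n _ _ (hagree n) (hp n)⟩

end Choice

/-! ### From long free sequences to an indiscernible one. -/

section FreeSequences

variable {L : FirstOrder.Language.{u, v}} {𝕄 : Type w} [L.Structure 𝕄] {D : Set 𝕄}
  {ι : Type} {R : (ι → 𝕄) → Set 𝕄 → Prop} {b : ι → 𝕄}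

theorem IsFreeOn.map {J K : Type x} [LinearOrder J] [LinearOrder K]
    {U : Ultrafilter (J → ι → 𝕄)} (hU : IsFreeOn L D R b U Set.univ) {h : K → J}
    (hh : StrictMono h) : IsFreeOn L D R b (U.map fun v => v ∘ h) Set.univ :=
  ⟨fun n u hu _ x hx => hU.free n (h ∘ u) (hh.comp hu) (fun _ => mem_univ _) x hx,
    fun j _ S hS hb => hU.base (h j) (mem_univ _) S hS hb⟩

variable (L D R b) in
/-- There are free sequences of any length in which the increasing `k`-tuples have the type `s k`,
for all `k ≤ n`. -/
def IsLongFreeType (s : ∀ k : ℕ, Set (Set (Fin k × ι → 𝕄))) (n : ℕ) : Prop :=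
  ∀ (J : Type w) [LinearOrder J] [WellFoundedLT J], ∃ U : Ultrafilter (J → ι → 𝕄),
    IsFreeOn L D R b U Set.univ ∧ ∀ k ≤ n, ∀ u : Fin k → J, StrictMono u → utype L D U u = s k

theorem exists_wellOrder_forall_embedding {C : Type w} (J : C → Type w)
    [∀ c, LinearOrder (J c)] [∀ c, WellFoundedLT (J c)] :
    ∃ (K : Type w) (_ : LinearOrder K) (_ : WellFoundedLT K), ∀ c, ∃ h : J c → K, StrictMono h := by
  let o : Ordinal.{w} := ⨆ c, Ordinal.type ((· < ·) : J c → J c → Prop)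
  refine ⟨o.ToType, inferInstance, inferInstance, fun c => ?_⟩
  have h1 : Ordinal.type ((· < ·) : J c → J c → Prop) ≤
      Ordinal.type ((· < ·) : o.ToType → o.ToType → Prop) := by
    rw [Ordinal.type_toType]
    exact Ordinal.le_iSup (fun c => Ordinal.type ((· < ·) : J c → J c → Prop)) c
  obtain ⟨f⟩ := Ordinal.type_le_iff'.1 h1
  exact ⟨f, fun a b hab => f.map_rel_iff.2 hab⟩

/-- If each candidate `t` failed at some length `J t`, one well-order `K` would contain all these
lengths. A sufficiently long free sequence has a homogeneous part of length `K`; restricting it to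
`J t`, where `t` is its colour, gives a contradiction. -/
theorem IsLongFreeType.exists_succ {s : ∀ k : ℕ, Set (Set (Fin k × ι → 𝕄))} {n : ℕ}
    (hs : IsLongFreeType L D R b s n) :
    ∃ t, IsLongFreeType L D R b (Function.update s (n + 1) t) (n + 1) := by
  by_contra hcon
  push Not at hcon
  unfold IsLongFreeType at hcon
  push Not at hcon
  choose J i₁ i₂ hJ using hcon
  obtain ⟨K, _, _, hK⟩ := exists_wellOrder_forall_embedding J
  obtain ⟨N, _, _, hN⟩ := exists_homogeneous (n + 1) (Set (Set (Fin (n + 1) × ι → 𝕄))) K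
  obtain ⟨U, hU, hUs⟩ := hs N
  obtain ⟨h, hh, t, ht⟩ := hN fun u => utype L D U u
  obtain ⟨g, hg⟩ := hK t
  obtain ⟨k, hk, u, hu, hne⟩ := hJ t (U.map fun v => v ∘ (h ∘ g)) (hU.map (hh.comp hg))
  apply hne
  rw [utype_map]
  rcases hk.lt_or_eq with hk | rfl
  · rw [Function.update_of_ne hk.ne]
    exact hUs k (Nat.lt_succ_iff.1 hk) _ ((hh.comp hg).comp hu)
  · rw [Function.update_self]
    exact ht (g ∘ u) (hg.comp hu)

theorem exists_isLongFreeType {κ : Cardinal.{w}} (h : IsMonster L 𝕄 κ) (hD : #D < κ)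
    [Finite ι] (hR : IsFreeness L D R) (hb : R b ∅) :
    ∃ s : ∀ k : ℕ, Set (Set (Fin k × ι → 𝕄)), ∀ n, IsLongFreeType L D R b s n := by
  have h0 : ∃ s : ∀ k : ℕ, Set (Set (Fin k × ι → 𝕄)), IsLongFreeType L D R b s 0 := by
    let t : Set (Set (Fin 0 × ι → 𝕄)) := {S | D.Definable L S ∧ isEmptyElim ∈ S}
    refine ⟨Function.update (fun _ => ∅) 0 t, fun J _ _ => ?_⟩
    obtain ⟨U, hU⟩ := exists_isFreeOn_univ h hD hR hb J
    refine ⟨U, hU, fun k hk u _ => ?_⟩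
    obtain rfl := Nat.le_zero.1 hk
    rw [Function.update_self]
    ext S
    have : ∀ v : J → ι → 𝕄, tup v u = isEmptyElim := fun v => Subsingleton.elim _ _
    simp [utype, t, this]
  obtain ⟨s₀, hs₀⟩ := h0
  refine exists_forall_of_update ⟨s₀, hs₀⟩ (fun n s hs => hs.exists_succ) fun n s t hst hs J _ _ => ?_
  obtain ⟨U, hU, hUs⟩ := hs J
  exact ⟨U, hU, fun k hk u hu => (hUs k hk u hu).trans (hst k hk)⟩

/-- A tuple which is free over `D` starts a `D`-indiscernible sequence each of whose members is free
from the previous ones. -/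
theorem IsFreeness.exists_indiscernible {κ : Cardinal.{w}} (h : IsMonster L 𝕄 κ) (hD : #D < κ)
    [Finite ι] (hR : IsFreeness L D R) (hb : R b ∅) :
    ∃ c : ℕ → ι → 𝕄, c 0 = b ∧ IsIndiscernible L D c ∧
      ∀ n, R (c n) (⋃ j < n, range (c j)) := by
  classical
  obtain ⟨s, hs⟩ := exists_isLongFreeType h hD hR hb
  -- Arbitrary lengths were needed only to fix the types `s k`; from here on length `ω` is enough.
  have hU : ∀ n, ∃ U : Ultrafilter (ULift.{w} ℕ → ι → 𝕄), IsFreeOn L D R b U Set.univ ∧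
      ∀ k ≤ n, ∀ u : Fin k → ULift.{w} ℕ, StrictMono u → utype L D U u = s k :=
    fun n => hs n (ULift.{w} ℕ)
  let up : ∀ {k : ℕ}, (Fin k → ℕ) → Fin k → ULift.{w} ℕ := fun u i => ULift.up (u i)
  have hup : ∀ {k : ℕ} {u : Fin k → ℕ}, StrictMono u → StrictMono (up u) := fun hu i j hij => hu hij
  have hval : ∀ k : ℕ, StrictMono (fun i : Fin k => (i : ℕ)) := fun k i j hij => hij
  have hcomp : ∀ {n k : ℕ} (f : Fin k → Fin n), StrictMono f → ∀ x ∈ ⋂₀ s n,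
      x ∘ Prod.map f id ∈ ⋂₀ s k := by
    intro n k f hf x hx
    obtain ⟨U, -, hUs⟩ := hU n
    have hkn : k ≤ n := by simpa using Fintype.card_le_of_injective f hf.injective
    rw [← hUs n le_rfl (up fun i => i) (hup (hval n))] at hx
    have := comp_mem_utype hx f
    rwa [hUs k hkn _ ((hup (hval n)).comp hf)] at this
  have hsame : ∀ {n : ℕ} {x x' : Fin n × ι → 𝕄}, x ∈ ⋂₀ s n → x' ∈ ⋂₀ s n → SameType L D x x' := by
    intro n x x' hx hx'
    obtain ⟨U, -, hUs⟩ := hU n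
    rw [← hUs n le_rfl (up fun i => i) (hup (hval n))] at hx hx'
    exact sameType_of_mem_utype hx hx'
  have hmem : ∀ {n : ℕ} {x x' : Fin n × ι → 𝕄}, x ∈ ⋂₀ s n → SameType L D x x' → x' ∈ ⋂₀ s n := by
    intro n x x' hx hx'
    obtain ⟨U, -, hUs⟩ := hU n
    rw [← hUs n le_rfl (up fun i => i) (hup (hval n))] at hx ⊢
    exact mem_utype_of_sameType hx hx'
  have hex : ∀ n, (⋂₀ s n).Nonempty := by
    intro n
    obtain ⟨U, -, hUs⟩ := hU n
    rw [← hUs n le_rfl (up fun i => i) (hup (hval n))]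
    exact exists_mem_utype h hD _ _
  have hlast : ∀ n, ∀ x ∈ ⋂₀ s (n + 1), LastFree R x := by
    intro n x hx
    obtain ⟨U, hUf, hUs⟩ := hU (n + 1)
    rw [← hUs (n + 1) le_rfl (up fun i => i) (hup (hval (n + 1)))] at hx
    exact hUf.free n _ (hup (hval (n + 1))) (fun _ => mem_univ _) x hx
  have hbase : (fun p : Fin 1 × ι => b p.2) ∈ ⋂₀ s 1 := by
    obtain ⟨U, hUf, hUs⟩ := hU 1
    rw [← hUs 1 le_rfl (up fun i => i) (hup (hval 1))]
    intro S hS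
    by_contra hn
    have h1 := hUf.base ⟨0⟩ (mem_univ _)
      {y : ι → 𝕄 | (fun p : Fin 1 × ι => y p.2) ∈ Sᶜ} (hS.1.compl.preimage_comp Prod.snd) hn
    obtain ⟨v, hv, hv'⟩ := (hS.2.and h1).exists
    apply hv'
    convert! hv using 1
    ext ⟨i, k⟩
    obtain rfl := Subsingleton.elim i 0
    rfl
  -- Saturation realises the type of `n + 1` tuples and homogeneity moves its first `n` onto the
  -- given ones, so only finite tuples are ever realised.
  have hext : ∀ n (v : ℕ → ι → 𝕄), tup v (fun i : Fin n => (i : ℕ)) ∈ ⋂₀ s n →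
      ∃ y : ι → 𝕄, tup (Function.update v n y) (fun i : Fin (n + 1) => (i : ℕ)) ∈ ⋂₀ s (n + 1) := by
    intro n v hv
    obtain ⟨x, hx⟩ := hex (n + 1)
    have hx' := hcomp Fin.castSucc Fin.strictMono_castSucc x hx
    obtain ⟨σ, hσ, hσx⟩ := h.exists_equiv hD (hsame hx' hv)
    refine ⟨fun k => σ (x (Fin.last n, k)), ?_⟩
    have hmem' := hmem hx (sameType_equiv σ hσ x)
    convert! hmem' using 1
    ext ⟨i, k⟩
    refine Fin.lastCases ?_ (fun i => ?_) i
    · simp [tup]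
    · have := congrFun hσx (i, k)
      simp only [Function.comp_apply, Prod.map_apply, id] at this
      rw [Function.comp_apply, this]
      simp [tup, Function.update_of_ne i.2.ne]
  obtain ⟨c, hc'⟩ := exists_forall_of_update
    (P := fun n (v : ℕ → ι → 𝕄) => v 0 = b ∧ tup v (fun i : Fin (n + 1) => (i : ℕ)) ∈ ⋂₀ s (n + 1))
    ⟨fun _ => b, rfl, hbase⟩
    (fun n v hv => (hext (n + 1) v hv.2).imp fun y hy => ⟨hv.1, hy⟩) (by
      rintro n v v' hvv ⟨hv0, hv⟩
      refine ⟨(hvv 0 (Nat.zero_le n)).symm.trans hv0, ?_⟩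
      have : tup v' (fun i : Fin (n + 1) => (i : ℕ)) = tup v (fun i : Fin (n + 1) => (i : ℕ)) := by
        ext ⟨i, k⟩
        exact congrFun (hvv i (Nat.lt_succ_iff.1 i.2)).symm k
      rwa [this])
  have hc := fun n => (hc' n).2
  refine ⟨c, (hc' 0).1, ?_, ?_⟩
  · have key : ∀ (n : ℕ) (i : Fin n → ℕ), StrictMono i → tup c i ∈ ⋂₀ s n := by
      intro n i hi
      obtain ⟨N, hN⟩ : ∃ N, ∀ k, i k ≤ N := ⟨Finset.univ.sup i, fun k => Finset.le_sup (Finset.mem_univ k)⟩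
      exact hcomp (fun k => (⟨i k, Nat.lt_succ_iff.2 (hN k)⟩ : Fin (N + 1))) (fun a b hab => hi hab)
        _ (hc N)
    intro n i j hi hj
    exact hsame (key n i hi) (key n j hj)
  · intro n
    have := hlast n _ (hc n)
    unfold LastFree at this
    convert! this using 1
    ext a
    simp only [mem_iUnion, mem_range, Function.comp_apply, tup]
    constructor
    · rintro ⟨j, hj, k, rfl⟩
      exact ⟨(⟨j, hj⟩, k), rfl⟩
    · rintro ⟨⟨j, k⟩, rfl⟩
      exact ⟨j, j.2, k, rfl⟩

end FreeSequences

/-! ### The global type of a free indiscernible sequence. -/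

section FreeTypes

variable {L : FirstOrder.Language.{u, v}} {𝕄 : Type w} [L.Structure 𝕄] {D : Set 𝕄}
  {ι : Type} {R : (ι → 𝕄) → Set 𝕄 → Prop}

theorem range_tup_val (c : ℕ → ι → 𝕄) (n : ℕ) :
    range (tup c fun i : Fin n => (i : ℕ)) = ⋃ j < n, range (c j) := by
  ext a
  simp only [mem_iUnion, mem_range, tup]
  constructor
  · rintro ⟨⟨j, k⟩, rfl⟩
    exact ⟨j, j.2, k, rfl⟩
  · rintro ⟨j, hj, k, rfl⟩
    exact ⟨(⟨j, hj⟩, k), rfl⟩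

/-- Compare the index sequences `0, …, n - 1, n` and `0, …, n - 1, N`. -/
theorem IsIndiscernible.sameType {c : ℕ → ι → 𝕄} (hc : IsIndiscernible L D c) {n N : ℕ}
    (hnN : n ≤ N) : SameType L (D ∪ ⋃ j < n, range (c j)) (c n) (c N) := by
  rw [← range_tup_val]
  apply SameType.union_range
  have h1 : StrictMono (Fin.snoc (fun i : Fin n => (i : ℕ)) N : Fin (n + 1) → ℕ) := by
    intro i j hij
    induction j using Fin.lastCases with
    | last =>
      induction i using Fin.lastCases with
      | last => exact absurd hij (lt_irrefl _)
      | cast i =>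
        simp only [Fin.snoc_castSucc, Fin.snoc_last]
        exact i.2.trans_le hnN
    | cast j =>
      induction i using Fin.lastCases with
      | last => exact absurd hij (not_lt.2 (Fin.castSucc_lt_last j).le)
      | cast i =>
        simp only [Fin.snoc_castSucc]
        exact hij
  have h2 := (hc (n + 1) (fun i => i) _ (fun i j hij => hij) h1).comp
    (Sum.elim (fun i => (Fin.last n, i)) (Prod.map Fin.castSucc id) :
      ι ⊕ (Fin n × ι) → Fin (n + 1) × ι)
  convert! h2 using 1
  · ext i
    rcases i with i | i <;> simp [tup]
  · ext i
    rcases i with i | i <;> simp [tup]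

/-- The global type of a free indiscernible sequence, given by an ultrafilter. -/
theorem IsFreeness.exists_ultrafilter (hR : IsFreeness L D R) [Finite ι] {c : ℕ → ι → 𝕄}
    (hind : IsIndiscernible L D c) (hfree : ∀ n, R (c n) (⋃ j < n, range (c j))) :
    ∃ Q : Ultrafilter (ι → 𝕄),
      (∀ (n : ℕ) (S : Set (ι → 𝕄)), (D ∪ ⋃ j < n, range (c j)).Definable L S → c n ∈ S →
        ∀ᶠ x in (Q : Filter (ι → 𝕄)), x ∈ S) ∧
      ∀ (B : Set 𝕄) (S : Set (ι → 𝕄)), B.Finite → (D ∪ B).Definable L S → (∀ b ∈ S, ¬ R b B) →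
        ∀ᶠ x in (Q : Filter (ι → 𝕄)), x ∉ S := by
  classical
  -- `F₁` will make the sequence Morley and `F₂` the type free. A finite part is met by a copy of `c
  -- N`, for large `N`, made free from the finitely many parameters involved.
  let F₁ : Set (Set (ι → 𝕄)) :=
    {S | ∃ n : ℕ, (D ∪ ⋃ j < n, range (c j)).Definable L S ∧ c n ∈ S}
  let F₂ : Set (Set (ι → 𝕄)) :=
    {s | ∃ (B : Set 𝕄) (S : Set (ι → 𝕄)), B.Finite ∧ (D ∪ B).Definable L S ∧ (∀ b ∈ S, ¬ R b B) ∧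
      s = Sᶜ}
  have hfin : ∀ n, (⋃ j < n, range (c j)).Finite := fun n =>
    (finite_Iio n).biUnion fun j _ => finite_range _
  have hsupp : ∀ s ∈ F₁ ∪ F₂, ∃ (n : ℕ) (B : Finset 𝕄), ∀ N ≥ n, ∀ B' : Set 𝕄, B'.Finite →
      (B : Set 𝕄) ⊆ B' → ∀ b, SameType L (D ∪ ⋃ j < N, range (c j)) (c N) b → R b B' → b ∈ s := by
    rintro s (⟨n, hS, hcS⟩ | ⟨B, S, hB, hS, hforce, rfl⟩)
    · refine ⟨n, ∅, fun N hN B' _ _ b hb _ => ?_⟩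
      have h1 : SameType L (D ∪ ⋃ j < n, range (c j)) (c N) b :=
        hb.mono (union_subset_union_right _
          (biUnion_subset_biUnion_left fun j (hj : j < n) => (hj.trans_le hN : j < N)))
      exact (sameType_iff_definable.1 ((hind.sameType hN).trans h1) s hS).1 hcS
    · refine ⟨0, hB.toFinset, fun N _ B' hB' hBB' b _ hRb hbS => hforce b hbS ?_⟩
      exact hR.mono _ _ _ hB' hRb (by simpa using hBB')
  obtain ⟨Q, hQ⟩ := Ultrafilter.exists_ultrafilter_of_finite_inter_nonempty (F₁ ∪ F₂) (by
    intro T hT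
    choose! n B hnB using hsupp
    let N := T.sup n
    obtain ⟨b, hb, hRb⟩ := hR.extension (c N) (⋃ j < N, range (c j))
      ((⋃ j < N, range (c j)) ∪ (T.biUnion B : Finset 𝕄))
      ((hfin N).union (Finset.finite_toSet _)) (hfree N) subset_union_left
    refine ⟨b, fun s hs => hnB s (hT hs) N (Finset.le_sup hs) _
      ((hfin N).union (Finset.finite_toSet _)) ?_ b hb hRb⟩
    exact subset_union_of_subset_right (Finset.coe_subset.2 (Finset.subset_biUnion_of_mem B hs)) _)
  exact ⟨Q, fun n S hS hc => hQ (Or.inl ⟨n, hS, hc⟩),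
    fun B S hB hS hforce => hQ (Or.inr ⟨B, S, hB, hS, hforce, rfl⟩)⟩

end FreeTypes

/-! ### Independence prevents Conant-dividing. -/

section FiniteIndependence

variable {L : FirstOrder.Language.{u, v}} {𝕄 : Type w} [L.Structure 𝕄] (κ : Cardinal.{w})
  (Ind : TernaryRel 𝕄) (M : L.ElementarySubstructure 𝕄)

/-- The properties of an independence relation over a fixed model `M`, for finite left sides, on
which chain local character rests. -/
structure IsIndepOver : Prop where
  invariant : ∀ σ : 𝕄 ≃[L] 𝕄, (∀ c ∈ (M : Set 𝕄), σ c = c) → ∀ A B : Set 𝕄, A.Finite → #B < κ →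
    Ind A M B → Ind (σ '' A) M (σ '' B)
  left_mono : ∀ A A' B : Set 𝕄, A.Finite → #B < κ → Ind A M B → A' ⊆ A → Ind A' M B
  right_mono : ∀ A B B' : Set 𝕄, A.Finite → #B < κ → Ind A M B → B' ⊆ B → Ind A M B'
  strongFiniteCharacter : ∀ {ι : Type} [Finite ι] (b : ι → 𝕄) (B : Set 𝕄), #B < κ →
    ¬ Ind (range b) M B → ∃ S, ((M : Set 𝕄) ∪ B).Definable L S ∧ b ∈ S ∧
      ∀ b' ∈ S, ¬ Ind (range b') M B
  extension : ∀ {ι : Type} [Finite ι] (b : ι → 𝕄) (B B' : Set 𝕄), #B' < κ →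
    Ind (range b) M B → B ⊆ B' → ∃ b', SameType L ((M : Set 𝕄) ∪ B) b b' ∧ Ind (range b') M B'
  of_subset : ∀ A B : Set 𝕄, A.Finite → #B < κ → A ⊆ (M : Set 𝕄) → Ind A M B

variable {κ Ind M}

theorem IsIndepOver.isFreeness (h𝕄 : IsMonster L 𝕄 κ) (hI : IsIndepOver κ Ind M) {E : Set 𝕄}
    (hE : #E < κ) (ι : Type) [Finite ι] :
    IsFreeness L ((M : Set 𝕄) ∪ E) fun (b : ι → 𝕄) B => Ind (range b) M (E ∪ B) where
  invariant := by
    intro σ hσ b B hB h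
    have h1 := hI.invariant σ (fun c hc => hσ c (Or.inl hc)) _ _ (finite_range b)
      (h𝕄.card_union_lt hE (h𝕄.card_finite_lt hB)) h
    have h2 : σ '' E = E := image_equiv_eq_self σ fun c hc => hσ c (Or.inr hc)
    rwa [image_union, h2, ← range_comp] at h1
  mono := fun b B B' hB h hBB => hI.right_mono _ _ _ (finite_range b)
    (h𝕄.card_union_lt hE (h𝕄.card_finite_lt hB)) h (union_subset_union_right _ hBB)
  strongFiniteCharacter := by
    intro b B hB h
    rw [union_assoc]
    exact hI.strongFiniteCharacter b _ (h𝕄.card_union_lt hE (h𝕄.card_finite_lt hB)) h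
  extension := by
    intro b B B' hB' h hBB
    rw [union_assoc]
    exact hI.extension b _ _ (h𝕄.card_union_lt hE (h𝕄.card_finite_lt hB')) h
      (union_subset_union_right _ hBB)

/-- A formula with a solution from which its parameters are independent does not Conant-divide. -/
theorem IsIndepOver.not_conantDivides [Nonempty 𝕄] (h𝕄 : IsMonster L 𝕄 κ)
    (hI : IsIndepOver κ Ind M) (hM : #(M : Set 𝕄) < κ) {E : Set 𝕄} (hE : #E < κ) {m : ℕ}
    {b : Fin m → 𝕄} (hb : Ind (range b) M E) {α : Type w'}
    (φ : L[[(M : Set 𝕄)]].Formula (α ⊕ Fin m)) {a : α → 𝕄} (ha : range a ⊆ E)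
    (hφ : φ.Realize (Sum.elim a b)) : ¬ ConantDivides κ Ind (M : Set 𝕄) φ b := by
  classical
  have hR := hI.isFreeness h𝕄 hE (Fin m)
  obtain ⟨c, hc0, hind, hfree⟩ := hR.exists_indiscernible h𝕄 (h𝕄.card_union_lt hM hE) (b := b)
    (by simpa using hb)
  obtain ⟨Q, hQ₁, hQ₂⟩ := hR.exists_ultrafilter hind hfree
  obtain ⟨q, hq⟩ := exists_isTypeOfUltrafilter_globalType (L := L) Q
  have hMorley : ∀ n, ∀ C ⊆ ((M : Set 𝕄) ∪ E) ∪ ⋃ j < n, range (c j),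
      q.RealizesRestrict C (c n) := by
    intro n C hC
    rw [hq.realizesRestrict_iff]
    intro S hS hQS
    by_contra hn
    obtain ⟨x, hx, hx'⟩ := (hQS.and (hQ₁ n Sᶜ (hS.mono hC).compl hn)).exists
    exact hx' hx
  have hqfree : IsFree κ Ind q (M : Set 𝕄) := by
    intro B hB x hx
    by_contra hn
    obtain ⟨S, hS, hxS, hforce⟩ := hI.strongFiniteCharacter x B hB hn
    obtain ⟨A₀, hA₀, hS₀⟩ := definable_iff_finitely_definable.1 hS
    have hsub : (A₀ : Set 𝕄) ⊆ (M : Set 𝕄) ∪ (B ∩ A₀) := fun z hz =>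
      (hA₀ hz).imp id fun hzB => ⟨hzB, hz⟩
    have hfin : (B ∩ (A₀ : Set 𝕄)).Finite := A₀.finite_toSet.inter_of_right B
    have hS₁ : ((M : Set 𝕄) ∪ (B ∩ A₀)).Definable L S := hS₀.mono hsub
    -- A tuple of `S` independent from the finite set `B ∩ A₀` would have a copy, still in `S`,
    -- independent from `B`. So `S` already forces dependence from a finite set, and `Q` omits it.
    have hQS := hQ₂ (B ∩ A₀) S hfin
      (hS₁.mono (union_subset_union_left _ subset_union_left)) (by
        intro b' hb' hind'
        have h1 : Ind (range b') M (B ∩ A₀) := hI.right_mono _ _ _ (finite_range b')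
          (h𝕄.card_union_lt hE (h𝕄.card_finite_lt hfin)) hind' subset_union_right
        obtain ⟨b'', hb'', hind''⟩ := hI.extension b' _ B hB h1 inter_subset_left
        exact hforce b'' ((sameType_iff_definable.1 hb'' S hS₁).1 hb') hind'')
    exact hq.realizesRestrict_iff.1 hx Sᶜ hS.compl hQS hxS
  have hseq : IsMorleyIn q (M : Set 𝕄) c := fun n =>
    hMorley n _ (union_subset_union_left _ subset_union_left)
  have hindM : IsIndiscernible L (M : Set 𝕄) c := fun n i j hi hj =>
    (hind n i j hi hj).mono subset_union_left
  have hq0 : q.RealizesRestrict (M : Set 𝕄) b := hc0 ▸ hMorley 0 _ (by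
    rw [union_assoc]
    exact subset_union_left)
  intro hdiv
  obtain ⟨s, hs⟩ := hdiv q hq0 hqfree c hseq hindM hc0
  -- `a` solves every instance, because the sequence is indiscernible over `E`, which contains `a`.
  refine hs ⟨a, fun i _ => ?_⟩
  have hdef : ((M : Set 𝕄) ∪ E).Definable L {y : Fin m → 𝕄 | φ.Realize (Sum.elim a y)} := by
    have h1 : (M : Set 𝕄).Definable L {z : Fin m ⊕ α → 𝕄 | φ.Realize (z ∘ Sum.swap)} := by
      have h2 : (M : Set 𝕄).Definable L (Set.ofPred φ.Realize) := ⟨φ, rfl⟩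
      exact h2.preimage_comp Sum.swap
    refine Definable.mono ?_ (union_subset_union_right _ ha)
    convert! definable_fiber h1 a using 1
    ext y
    simp only [mem_ofPred_eq]
    apply iff_of_eq
    congr 1
    ext i
    rcases i with i | i <;> rfl
  have h3 := hind.sameType (Nat.zero_le i)
  rw [hc0] at h3
  exact (sameType_iff_definable.1 h3 _ (hdef.mono subset_union_left)).1 hφ

end FiniteIndependence

/-! ### A reflecting stage of a continuous chain. -/

section Chains

variable {L : FirstOrder.Language.{u, v}} {𝕄 : Type w} [L.Structure 𝕄]

theorem aleph0_lt_of_theoryCard_lt {μ : Cardinal.{w}}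
    (hT : Cardinal.lift.{w} (theoryCard L) < Cardinal.lift.{max u v} μ) : ℵ₀ < μ := by
  have h1 : ℵ₀ ≤ Cardinal.lift.{w} (theoryCard L) := by
    rw [aleph0_le_lift]
    exact le_max_left _ _
  have := h1.trans_lt hT
  rwa [aleph0_lt_lift] at this

/-- Variables indexed by `ℕ` treat all finite arities at once. -/
theorem card_definable_lt {μ : Cardinal.{w}}
    (hT : Cardinal.lift.{w} (theoryCard L) < Cardinal.lift.{max u v} μ) {B : Set 𝕄}
    (hB : #B < μ) : #{W : Set (ℕ → 𝕄) // B.Definable L W} < μ := by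
  have hμ := aleph0_lt_of_theoryCard_lt hT
  have h1 : Cardinal.lift.{max u v} #{W : Set (ℕ → 𝕄) // B.Definable L W} ≤
      #(L.Formula (B ⊕ ℕ)) := by
    have hsurj : Function.Surjective (fun φ : ULift.{max u v w} (L.Formula (B ⊕ ℕ)) =>
        (ULift.up ⟨{x | φ.down.Realize (Sum.elim (↑) x)},
          definable_iff_exists_formula_sum.2 ⟨φ.down, rfl⟩⟩ :
          ULift.{max u v} {W : Set (ℕ → 𝕄) // B.Definable L W})) := by
      rintro ⟨W, hW⟩
      obtain ⟨φ, rfl⟩ := definable_iff_exists_formula_sum.1 hW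
      exact ⟨⟨φ⟩, rfl⟩
    have := mk_le_of_surjective hsurj
    simpa [mk_uLift] using this
  have h2 : #(L.Formula (B ⊕ ℕ)) ≤ max ℵ₀ (Cardinal.lift.{max u v} #(B ⊕ ℕ) +
      Cardinal.lift.{w} L.card) := by
    have h3 : #(L.Formula (B ⊕ ℕ)) ≤ #(Σ n, L.BoundedFormula (B ⊕ ℕ) n) :=
      mk_le_of_injective (f := fun φ => ⟨0, φ⟩) fun φ ψ h => by simpa using h
    exact h3.trans BoundedFormula.card_le
  have hμ' : ℵ₀ < Cardinal.lift.{max u v} μ := aleph0_lt_lift.2 hμ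
  have hBN : #(B ⊕ ℕ) < μ := by
    rw [mk_sum]
    simpa using add_lt_of_lt hμ.le hB hμ
  have hL : Cardinal.lift.{w} L.card < Cardinal.lift.{max u v} μ :=
    (lift_le.2 (le_max_right _ _)).trans_lt hT
  exact lift_lt.1 ((h1.trans h2).trans_lt
    (max_lt hμ' (add_lt_of_lt hμ'.le (lift_lt.2 hBN) hL)))

theorem exists_reflecting {A : Set 𝕄} {μ : Cardinal.{w}} (hA : A.Finite)
    (hμ : μ.IsRegular) (hT : Cardinal.lift.{w} (theoryCard L) < Cardinal.lift.{max u v} μ)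
    {M : Ordinal.{w} → L.ElementarySubstructure 𝕄} (hM : IsContinuousChain L μ M)
    (hcard : ∀ i < μ.ord, #(M i : Set 𝕄) < μ) :
    ∃ i < μ.ord, ∀ W : Set (ℕ → 𝕄), ((M i : Set 𝕄) ∪ A).Definable L W →
      (∃ c ∈ W, ∀ k, c k ∈ ⋃ j < μ.ord, (M j : Set 𝕄)) → ∃ c ∈ W, ∀ k, c k ∈ M i := by
  classical
  have hμ0 := aleph0_lt_of_theoryCard_lt hT
  have hsup : ∀ f : ℕ → Ordinal.{w}, (∀ n, f n < μ.ord) → ⨆ n, f n < μ.ord := by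
    intro f hf
    exact Ordinal.lift_iSup_lt_of_lt_cof (by simpa [hμ.cof_ord] using hμ0) hf
  have hpos : (0 : Ordinal.{w}) < μ.ord := by
    rw [lt_ord]
    simpa using hμ.pos
  -- A witness has countably many coordinates, so it lies in one stage, as `μ` is regular and
  -- uncountable. Stage `0` is a default for sets without a witness.
  have hH : ∀ W : Set (ℕ → 𝕄), ∃ i < μ.ord,
      (∃ c ∈ W, ∀ k, c k ∈ ⋃ j < μ.ord, (M j : Set 𝕄)) → ∃ c ∈ W, ∀ k, c k ∈ M i := by
    intro W
    by_cases hW : ∃ c ∈ W, ∀ k, c k ∈ ⋃ j < μ.ord, (M j : Set 𝕄)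
    · obtain ⟨c, hcW, hc⟩ := hW
      simp only [mem_iUnion] at hc
      choose f hf hcf using hc
      have hlt := hsup f hf
      exact ⟨⨆ n, f n, hlt, fun _ => ⟨c, hcW, fun k =>
        hM.1 _ _ (Ordinal.le_iSup f k) hlt (hcf k)⟩⟩
    · exact ⟨0, hpos, fun h => (hW h).elim⟩
  choose H hHlt hH using hH
  -- `G j` bounds the stages needed by all sets definable over `M j ∪ A`.
  let G : Ordinal.{w} → Ordinal.{w} := fun j =>
    ⨆ W : {W : Set (ℕ → 𝕄) // ((M j : Set 𝕄) ∪ A).Definable L W}, H W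
  have hG : ∀ j < μ.ord, G j < μ.ord := by
    intro j hj
    refine Ordinal.iSup_lt_of_lt_cof (hμ.cof_ord.symm ▸ card_definable_lt hT ?_) fun W => hHlt W
    exact (mk_union_le _ _).trans_lt (add_lt_of_lt hμ.aleph0_le (hcard j hj)
      ((lt_aleph0_iff_set_finite.2 hA).trans hμ0))
  have hlim := isSuccLimit_ord hμ.aleph0_le
  let s : ℕ → Ordinal.{w} := fun n => Nat.rec 0 (fun _ i => Order.succ (max i (G i))) n
  have hs : ∀ n, s (n + 1) = Order.succ (max (s n) (G (s n))) := fun n => rfl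
  have hslt : ∀ n, s n < μ.ord := by
    intro n
    induction n with
    | zero => exact hpos
    | succ n ih => exact hlim.succ_lt (max_lt ih (hG _ ih))
  have hs1 : ∀ n, s n < s (n + 1) := fun n => Order.lt_succ_of_le (le_max_left _ _)
  have hs2 : ∀ n, G (s n) < s (n + 1) := fun n => Order.lt_succ_of_le (le_max_right _ _)
  have hsmono : StrictMono s := strictMono_nat_of_lt_succ hs1
  let i := ⨆ n, s n
  have hi : i < μ.ord := hsup s hslt
  have hsi : ∀ n, s n < i := fun n => (hs1 n).trans_le (Ordinal.le_iSup s (n + 1))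
  have hilim : Order.IsSuccLimit i := by
    refine ⟨fun hmin => ?_, fun a ha => ?_⟩
    · exact (hsi 0).not_ge (hmin (hsi 0).le)
    · obtain ⟨n, hn⟩ := Ordinal.lt_iSup_iff.1 ha.lt
      exact ha.2 hn (hsi n)
  have hMi : (M i : Set 𝕄) ⊆ ⋃ n, (M (s n) : Set 𝕄) := by
    rw [hM.2 i hi hilim]
    refine iUnion₂_subset fun j hj => ?_
    obtain ⟨n, hn⟩ := Ordinal.lt_iSup_iff.1 hj
    exact (hM.1 _ _ hn.le (hslt n)).trans (subset_iUnion (fun n => (M (s n) : Set 𝕄)) n)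
  refine ⟨i, hi, fun W hW hWM => ?_⟩
  -- Finitely many parameters define `W`, so it is already definable over `M (s n) ∪ A` for some `n`
  -- and has its witness by stage `s (n + 1)`.
  obtain ⟨A₀, hA₀, hW₀⟩ := definable_iff_finitely_definable.1 hW
  have hdir : Monotone fun n => (M (s n) : Set 𝕄) ∪ A := fun n n' hn =>
    union_subset_union_left _ (hM.1 _ _ (hsmono.monotone hn) (hslt n'))
  obtain ⟨n, hn⟩ : ∃ n, (A₀ : Set 𝕄) ⊆ (M (s n) : Set 𝕄) ∪ A := by
    refine DirectedOn.exists_mem_subset_of_finset_subset_biUnion (c := Set.univ) (s := A₀)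
      (f := fun n => (M (s n) : Set 𝕄) ∪ A) ⟨0, trivial⟩ ?_ ?_ |>.imp fun n h => h.2
    · exact fun a _ b _ => ⟨max a b, trivial, hdir (le_max_left _ _), hdir (le_max_right _ _)⟩
    · intro z hz
      rcases hA₀ hz with hz | hz
      · obtain ⟨n, hn⟩ := mem_iUnion.1 (hMi hz)
        exact mem_biUnion (mem_univ n) (Or.inl hn)
      · exact mem_biUnion (mem_univ 0) (Or.inr hz)
  obtain ⟨c, hcW, hc⟩ := hH W hWM
  refine ⟨c, hcW, fun k => hM.1 _ _ ?_ hi (hc k)⟩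
  have h1 : H W ≤ G (s n) := Ordinal.le_iSup
    (fun W : {W : Set (ℕ → 𝕄) // ((M (s n) : Set 𝕄) ∪ A).Definable L W} => H W)
    ⟨W, hW₀.mono hn⟩
  exact (h1.trans (hs2 n).le).trans (hsi (n + 1)).le

end Chains

/-! ### Reflection gives Conant-independence. -/

section Main

variable {L : FirstOrder.Language.{u, v}} {𝕄 : Type w} [L.Structure 𝕄] {κ : Cardinal.{w}}
  {Ind : TernaryRel 𝕄}

/-- If the sets definable over `N ∪ A` which meet a set `C` of parameters meet `N`, then `A` is
Conant-independent from `C` over `N`. -/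
theorem conantIndep_of_reflecting [Nonempty 𝕄] (h𝕄 : IsMonster L 𝕄 κ)
    {N : L.ElementarySubstructure 𝕄} (hN : #(N : Set 𝕄) < κ) (hI : IsIndepOver κ Ind N)
    {A C : Set 𝕄} (hA : A.Finite) (hNC : (N : Set 𝕄) ⊆ C)
    (href : ∀ (p : ℕ) (W : Set (Fin p → 𝕄)), ((N : Set 𝕄) ∪ A).Definable L W →
      (∃ c ∈ W, ∀ k, c k ∈ C) → ∃ c ∈ W, ∀ k, c k ∈ N) :
    ConantIndep L κ Ind A N C := by
  classical
  rintro ⟨φ, hφ, n, m, ψ, d, hdiv, himp⟩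
  have hAκ : #A < κ := h𝕄.card_finite_lt hA
  have hX : C.Definable L (Set.ofPred φ.Realize) :=
    Definable.mono ⟨φ, rfl⟩ (union_subset hNC subset_rfl)
  obtain ⟨A₀, hA₀, hX₀⟩ := definable_iff_finitely_definable.1 hX
  let c : Fin A₀.card → 𝕄 := fun k => A₀.equivFin.symm k
  have hc : range c = A₀ := by
    ext z
    constructor
    · rintro ⟨k, rfl⟩
      exact (A₀.equivFin.symm k).2
    · intro hz
      exact ⟨A₀.equivFin ⟨z, hz⟩, by simp [c]⟩
  obtain ⟨Φ, hΦ, hXΦ⟩ := exists_definable_fiber (C := (∅ : Set 𝕄)) (e := c)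
    (by rwa [empty_union, hc])
  let a : A → 𝕄 := fun x => x
  have hφ' : ∀ x : A → 𝕄, φ.Realize x ↔ Sum.elim x c ∈ Φ := fun x => Set.ext_iff.1 hXΦ x
  let ι : Type := Fin A₀.card ⊕ (Σ k : Fin n, Fin (m k))
  let e₀ : ι → 𝕄 := Sum.elim c fun z => d z.1 z.2
  let V : Set (Fin A₀.card → 𝕄) := {y | Sum.elim a y ∈ Φ}
  have hV : ((N : Set 𝕄) ∪ A).Definable L V := by
    have h1 := definable_fiber (hΦ.preimage_comp (Sum.swap : A ⊕ Fin A₀.card → Fin A₀.card ⊕ A)) a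
    refine Definable.mono ?_ (?_ : ∅ ∪ range a ⊆ _)
    · convert! h1 using 1
      ext y
      simp only [V, mem_ofPred_eq, mem_preimage]
      apply iff_of_eq
      congr 1
      ext i
      rcases i with i | i <;> rfl
    · rintro z (hz | ⟨x, rfl⟩)
      · exact hz.elim
      · exact Or.inr x.2
  let V' : Set (ι → 𝕄) := {e | e ∘ Sum.inl ∈ V}
  have hV' : ((N : Set 𝕄) ∪ A).Definable L V' := hV.preimage_comp Sum.inl
  let F₁ : Set (Set (ι → 𝕄)) := {S | (N : Set 𝕄).Definable L S ∧ e₀ ∈ S}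
  let F₃ : Set (Set (ι → 𝕄)) := {s | ∃ S, ((N : Set 𝕄) ∪ A).Definable L S ∧
    (∀ e ∈ S, ¬ Ind (range e) N A) ∧ s = Sᶜ}
  -- A point `e` of the intersection has the type of `e₀` over `N`, satisfies `φ` with `A`, and is
  -- independent from `A`.
  by_cases hne : (⋂₀ (F₁ ∪ {V'} ∪ F₃)).Nonempty
  · obtain ⟨e, he⟩ := hne
    have hsame : SameType L (N : Set 𝕄) e₀ e :=
      sameType_of_definable_imp fun S hS heS => he S (Or.inl (Or.inl ⟨hS, heS⟩))
    have heV : Sum.elim a (e ∘ Sum.inl) ∈ Φ := he V' (Or.inl (Or.inr rfl))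
    have heI : Ind (range e) N A := by
      by_contra hn
      obtain ⟨S, hS, heS, hforce⟩ := hI.strongFiniteCharacter e A hAκ hn
      exact he Sᶜ (Or.inr ⟨S, hS, hforce, rfl⟩) heS
    obtain ⟨σ, hσ, hσe⟩ := h𝕄.exists_equiv hN hsame.symm
    have h1 : Sum.elim (σ ∘ a) c ∈ Φ := by
      have h2 := (mem_definable_equiv_iff hΦ σ (by simp) _).2 heV
      convert! h2 using 1
      ext i
      rcases i with i | i
      · rfl
      · have := congrFun hσe (Sum.inl i)
        exact this.symm
    obtain ⟨k, hk⟩ := himp (σ ∘ a) ((hφ' _).2 h1)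
    have hd : d k = σ ∘ (e ∘ fun l => Sum.inr ⟨k, l⟩) := by
      ext l
      exact (congrFun hσe (Sum.inr ⟨k, l⟩)).symm
    have h3 : Ind (range (d k)) N (σ '' A) := by
      have h4 := hI.left_mono _ (range (e ∘ fun l => Sum.inr ⟨k, l⟩)) _ (finite_range e) hAκ heI
        (range_comp_subset_range _ _)
      have h5 := hI.invariant σ hσ _ _ (finite_range _) hAκ h4
      rwa [← range_comp, ← hd] at h5
    refine hI.not_conantDivides h𝕄 hN (h𝕄.card_finite_lt (hA.image σ)) h3 (ψ k) (a := σ ∘ a) ?_ hk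
      (hdiv k)
    rw [range_comp]
    exact image_mono (by rintro _ ⟨x, rfl⟩; exact x.2)
  · have hdef : ∀ S ∈ F₁ ∪ {V'} ∪ F₃, ((N : Set 𝕄) ∪ A).Definable L S := by
      rintro S ((⟨hS, -⟩ | rfl) | ⟨S, hS, -, rfl⟩)
      · exact hS.mono subset_union_left
      · exact hV'
      · exact hS.compl
    have hfip := mt (h𝕄.exists_mem_sInter (h𝕄.card_union_lt hN hAκ) hdef) hne
    push Not at hfip
    obtain ⟨T, hT, hTempty⟩ := hfip
    -- An inconsistent finite part is refuted inside `N`: reflection supplies the coordinates in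
    -- place of `c`, elementarity those in place of `d`, and a tuple of `N` avoids every set forcing
    -- dependence.
    let T' := T.filter fun S => (N : Set 𝕄).Definable L S ∧ e₀ ∈ S
    let S₁ : Set (ι → 𝕄) := ⋂ S : T', (S : Set (ι → 𝕄))
    have hS₁ : (N : Set 𝕄).Definable L S₁ :=
      definable_iInter_of_finite fun S => (Finset.mem_filter.1 S.2).2.1
    have heS₁ : e₀ ∈ S₁ := mem_iInter.2 fun S => (Finset.mem_filter.1 S.2).2.2
    obtain ⟨c', ⟨⟨z₀, hz₀⟩, hc'V⟩, hc'N⟩ := href A₀.card ({y | ∃ z, Sum.elim y z ∈ S₁} ∩ V)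
      ((hS₁.exists_of_finite.mono subset_union_left).inter hV)
      ⟨c, ⟨⟨_, heS₁⟩, (hφ' a).1 hφ⟩, fun k => hA₀ (hc ▸ mem_range_self k)⟩
    have hfib : (N : Set 𝕄).Definable L {z : (Σ k : Fin n, Fin (m k)) → 𝕄 | Sum.elim c' z ∈ S₁} := by
      have h1 := definable_fiber (hS₁.preimage_comp
        (Sum.swap : ι → (Σ k : Fin n, Fin (m k)) ⊕ Fin A₀.card)) c'
      refine Definable.mono ?_ (?_ : (N : Set 𝕄) ∪ range c' ⊆ _)
      · convert! h1 using 1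
        ext y
        simp only [mem_ofPred_eq, mem_preimage]
        apply iff_of_eq
        congr 1
        ext i
        rcases i with i | i <;> rfl
      · rintro z (hz | ⟨x, rfl⟩)
        · exact hz
        · exact hc'N x
    obtain ⟨z, hz, hzN⟩ := definable_elementary hfib ⟨z₀, hz₀⟩
    let e : ι → 𝕄 := Sum.elim c' z
    have heI : Ind (range e) N A := hI.of_subset _ _ (finite_range e) hAκ (by
      rintro _ ⟨i, rfl⟩
      rcases i with i | i
      · exact hc'N i
      · exact hzN i)
    have heT : e ∈ ⋂₀ (T : Set (Set (ι → 𝕄))) := by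
      intro S hS
      rcases hT hS with (hS₂ | rfl) | ⟨S, -, hforce, rfl⟩
      · exact mem_iInter.1 hz ⟨S, Finset.mem_filter.2 ⟨hS, hS₂⟩⟩
      · exact hc'V
      · exact fun heS => hforce e heS heI
    rw [hTempty] at heT
    exact heT

theorem chainLocalCharacter_conantIndep [Nonempty 𝕄] (h𝕄 : IsMonster L 𝕄 κ)
    (hI : ∀ N : L.ElementarySubstructure 𝕄, #(N : Set 𝕄) < κ → IsIndepOver κ Ind N) :
    ChainLocalCharacter L κ (ConantIndep L κ Ind) := by
  intro A hA μ hμ hμκ hT M hM hcard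
  obtain ⟨i, hi, href⟩ := exists_reflecting hA hμ hT hM hcard
  have hiκ := (hcard i hi).trans hμκ
  refine ⟨i, hi, conantIndep_of_reflecting h𝕄 hiκ (hI _ hiκ) hA
    (subset_biUnion_of_mem (u := fun j => (M j : Set 𝕄)) (show i ∈ {j | j < μ.ord} from hi)) ?_⟩
  rintro p W hW ⟨c, hcW, hc⟩
  obtain ⟨x₀⟩ : Nonempty (M i) := inferInstance
  -- Finite tuples are padded by `x₀` to sequences indexed by `ℕ`.
  obtain ⟨c', hc', hc'M⟩ := href {y | y ∘ (fun k : Fin p => (k : ℕ)) ∈ W} (hW.preimage_comp _)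
    ⟨fun k => if h : k < p then c ⟨k, h⟩ else x₀, by
      rw [mem_ofPred_eq]
      convert! hcW using 1
      ext k
      simp, by
      intro k
      by_cases h : k < p
      · simpa only [h, dite_true] using hc ⟨k, h⟩
      · simp only [h, dite_false]
        exact mem_biUnion (show i ∈ {j | j < μ.ord} from hi) x₀.2⟩
  exact ⟨_, hc', fun k => hc'M k⟩

end Main

/-! ### The properties over a fixed model follow from the axioms. -/

section Axioms

variable {L : FirstOrder.Language.{u, v}} {𝕄 : Type w} [L.Structure 𝕄] {κ : Cardinal.{w}}
  {Ind : TernaryRel 𝕄}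

theorem eq_of_sameType_of_subset {C A : Set 𝕄} (hAC : A ⊆ C) {f : A → 𝕄}
    (h : SameType L C (fun x : A => (x : 𝕄)) f) (x : A) : f x = x := by
  have h1 : C.Definable L {y : A → 𝕄 | y x = (x : 𝕄)} := by
    rw [definable_iff_exists_formula_sum]
    refine ⟨Term.equal (Term.var (Sum.inr x)) (Term.var (Sum.inl ⟨x, hAC x.2⟩)), ?_⟩
    ext y
    simp [Formula.realize_equal]
  exact (sameType_iff_definable.1 h _ h1).1 rfl

theorem isIndepOver_of_axioms (h𝕄 : IsMonster L 𝕄 κ) (hinv : IsIndependenceRelation L Ind)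
    (hex : FullExistence L κ Ind) (hmono : Monotonicity L κ Ind)
    (hsfc : StrongFiniteCharacter L κ Ind) (hext : RightExtension L κ Ind)
    (M : L.ElementarySubstructure 𝕄) (hM : #(M : Set 𝕄) < κ) : IsIndepOver κ Ind M where
  invariant := by
    intro σ hσ A B _ _ h
    have h1 := hinv σ _ _ _ h
    have h2 : σ '' (M : Set 𝕄) = M := image_equiv_eq_self σ hσ
    rwa [h2] at h1
  left_mono := fun A A' B hA hB h hAA => hmono.1 M A A' B hM (h𝕄.card_finite_lt hA) hB h hAA
  right_mono := fun A B B' hA hB h hBB => hmono.2 M A B B' hM (h𝕄.card_finite_lt hA) hB h hBB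
  strongFiniteCharacter := by
    intro ι _ b B hB h
    obtain ⟨φ, hφ, hforce⟩ := hsfc M _ B hM (h𝕄.card_finite_lt (finite_range b)) hB h
    have hS : ((M : Set 𝕄) ∪ B).Definable L (Set.ofPred φ.Realize) := ⟨φ, rfl⟩
    -- The axiom enumerates the range without repetition, so one coordinate per element is selected.
    -- The selected part of `b'` may have smaller range, whence left monotonicity.
    refine ⟨{y | y ∘ rangeSplitting b ∈ Set.ofPred φ.Realize}, hS.preimage_comp _, ?_, ?_⟩
    · rw [mem_ofPred_eq, comp_rangeSplitting]
      exact hφ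
    · intro b' hb' h'
      refine hforce _ hb' ?_
      exact hmono.1 M _ _ B hM (h𝕄.card_finite_lt (finite_range b')) hB h'
        (range_comp_subset_range _ _)
  extension := by
    intro ι _ b B B' hB' h hBB
    obtain ⟨A', ⟨f, rfl, hf⟩, hA'⟩ := hext M _ B B' hM (h𝕄.card_finite_lt (finite_range b))
      ((mk_le_mk_of_subset hBB).trans_lt hB') hB' h hBB
    refine ⟨f ∘ rangeFactorization b, hf.comp (rangeFactorization b), ?_⟩
    rwa [rangeFactorization_surjective.range_comp]
  of_subset := by
    intro A B hA hB hAM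
    -- A copy over `M` of a subset of `M` is that subset itself.
    obtain ⟨A', ⟨f, rfl, hf⟩, hA'⟩ := hex M A B hM (h𝕄.card_finite_lt hA) hB
    have h1 : f = fun x : A => (x : 𝕄) := funext fun x => eq_of_sameType_of_subset hAM hf x
    rwa [h1, Subtype.range_coe] at hA'

end Axioms

/-! ### Invariant independence for finite left sides. -/

section Invariant

variable (L : FirstOrder.Language.{u, v}) {𝕄 : Type w} [L.Structure 𝕄] {ι : Type x}

/-- The ultrafilter `Q` defines a type which is invariant over `M`. -/
def IsInvariantUltrafilter (M : Set 𝕄) (Q : Ultrafilter (ι → 𝕄)) : Prop :=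
  ∀ σ : 𝕄 ≃[L] 𝕄, (∀ c ∈ M, σ c = c) → ∀ φ : L[[𝕄]].Formula ι,
    ∀ᶠ x in (Q : Filter (ι → 𝕄)), (φ.Realize x ↔ φ.Realize (σ.symm ∘ x))

/-- The type of the tuple `b` over `C` extends to a global type invariant over `M`. -/
def HasInvariantExtension (M C : Set 𝕄) (b : ι → 𝕄) : Prop :=
  ∃ Q : Ultrafilter (ι → 𝕄), IsInvariantUltrafilter L M Q ∧
    ∀ S : Set (ι → 𝕄), C.Definable L S → b ∈ S → ∀ᶠ x in (Q : Filter (ι → 𝕄)), x ∈ S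

variable {L} {M C B : Set 𝕄} {b : ι → 𝕄}

theorem HasInvariantExtension.mono (h : HasInvariantExtension L M C b) (hBC : B ⊆ C) :
    HasInvariantExtension L M B b :=
  h.imp fun _ hQ => ⟨hQ.1, fun S hS => hQ.2 S (hS.mono hBC)⟩

theorem HasInvariantExtension.comp {ι' : Type y} (h : HasInvariantExtension L M C b)
    (f : ι' → ι) : HasInvariantExtension L M C (b ∘ f) := by
  obtain ⟨Q, hQ, hbQ⟩ := h
  refine ⟨Q.map fun x => x ∘ f, fun σ hσ φ => ?_, fun S hS hb => ?_⟩
  · have := hQ σ hσ (φ.relabel f)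
    simp only [Formula.realize_relabel] at this
    exact this
  · exact hbQ _ (hS.preimage_comp f) hb

theorem definable_preimage_equiv (σ : 𝕄 ≃[L] 𝕄) {S : Set (ι → 𝕄)}
    (hS : (σ '' C).Definable L S) : C.Definable L {x | σ ∘ x ∈ S} := by
  rw [definable_iff_exists_formula_sum] at hS ⊢
  obtain ⟨φ, rfl⟩ := hS
  have hmem : ∀ c : ↥(σ '' C), σ.symm c ∈ C := by
    rintro ⟨_, c, hc, rfl⟩
    simpa using hc
  refine ⟨φ.relabel (Sum.map (fun c : ↥(σ '' C) => ⟨σ.symm c, hmem c⟩) id), ?_⟩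
  ext x
  rw [mem_ofPred_eq, mem_ofPred_eq, mem_ofPred_eq, Formula.realize_relabel]
  refine Iff.trans (iff_of_eq ?_) (StrongHomClass.realize_formula σ φ)
  congr 1
  ext i
  rcases i with i | i <;> simp

/-- The same ultrafilter serves, since its type is invariant under `σ`. -/
theorem HasInvariantExtension.image (h : HasInvariantExtension L M C b) (σ : 𝕄 ≃[L] 𝕄)
    (hσ : ∀ c ∈ M, σ c = c) : HasInvariantExtension L M (σ '' C) (σ ∘ b) := by
  obtain ⟨Q, hQ, hbQ⟩ := h
  refine ⟨Q, hQ, fun S hS hb => ?_⟩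
  have h1 := hbQ _ (definable_preimage_equiv σ hS) hb
  obtain ⟨φ, rfl⟩ := exists_formula_of_definable hS
  have hσ' : ∀ c ∈ M, σ.symm c = c := fun c hc => by
    conv_lhs => rw [← hσ c hc]
    simp
  filter_upwards [h1, hQ σ.symm hσ' φ] with x hx hx'
  exact hx'.2 hx

/-- By compactness, finitely many sets in the type of `b` already contradict invariance; their
intersection forces. -/
theorem HasInvariantExtension.exists_definable_forcing [Finite ι]
    (h : ¬ HasInvariantExtension L M C b) : ∃ S : Set (ι → 𝕄), C.Definable L S ∧ b ∈ S ∧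
      ∀ b' ∈ S, ¬ HasInvariantExtension L M C b' := by
  classical
  let F₁ : Set (Set (ι → 𝕄)) := {S | C.Definable L S ∧ b ∈ S}
  let F₂ : Set (Set (ι → 𝕄)) := {s | ∃ σ : 𝕄 ≃[L] 𝕄, (∀ c ∈ M, σ c = c) ∧
    ∃ φ : L[[𝕄]].Formula ι, s = {x | φ.Realize x ↔ φ.Realize (σ.symm ∘ x)}}
  have hfip : ¬ ∀ T : Finset (Set (ι → 𝕄)), (T : Set (Set (ι → 𝕄))) ⊆ F₁ ∪ F₂ →
      (⋂₀ (T : Set (Set (ι → 𝕄)))).Nonempty := by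
    intro hT
    obtain ⟨Q, hQ⟩ := Ultrafilter.exists_ultrafilter_of_finite_inter_nonempty _ hT
    exact h ⟨Q, fun σ hσ φ => hQ (Or.inr ⟨σ, hσ, φ, rfl⟩), fun S hS hb => hQ (Or.inl ⟨hS, hb⟩)⟩
  push Not at hfip
  obtain ⟨T, hT, hTempty⟩ := hfip
  let T' := T.filter fun S => C.Definable L S ∧ b ∈ S
  let S₁ : Set (ι → 𝕄) := ⋂ S : T', (S : Set (ι → 𝕄))
  refine ⟨S₁, definable_iInter_of_finite fun S => (Finset.mem_filter.1 S.2).2.1,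
    mem_iInter.2 fun S => (Finset.mem_filter.1 S.2).2.2, ?_⟩
  rintro b' hb' ⟨Q, hQ, hbQ⟩
  have : ∀ᶠ x in (Q : Filter (ι → 𝕄)), ∀ S ∈ T, x ∈ S := by
    rw [Filter.eventually_all_finset]
    intro S hS
    rcases hT hS with hS₁ | ⟨σ, hσ, φ, rfl⟩
    · exact hbQ S hS₁.1 (mem_iInter.1 hb' ⟨S, Finset.mem_filter.2 ⟨hS, hS₁⟩⟩)
    · exact hQ σ hσ φ
  obtain ⟨x, hx⟩ := this.exists
  have hx' : x ∈ ⋂₀ (T : Set (Set (ι → 𝕄))) := fun S hS => hx S hS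
  rw [hTempty] at hx'
  exact hx'

/-- Realise over `B` the type given by the invariant ultrafilter. -/
theorem HasInvariantExtension.exists_extension {κ : Cardinal.{w}} (h𝕄 : IsMonster L 𝕄 κ)
    [Finite ι] (h : HasInvariantExtension L M C b) (hB : #B < κ) (hCB : C ⊆ B) :
    ∃ b', SameType L C b b' ∧ HasInvariantExtension L M B b' := by
  obtain ⟨Q, hQ, hbQ⟩ := h
  obtain ⟨b', hb'⟩ := h𝕄.exists_mem_sInter hB
    (F := {S : Set (ι → 𝕄) | B.Definable L S ∧ ∀ᶠ x in (Q : Filter (ι → 𝕄)), x ∈ S})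
    (fun S hS => hS.1) (by
      intro T hT
      have : ∀ᶠ x in (Q : Filter (ι → 𝕄)), ∀ S ∈ T, x ∈ S := by
        rw [Filter.eventually_all_finset]
        exact fun S hS => (hT hS).2
      obtain ⟨x, hx⟩ := this.exists
      exact ⟨x, fun S hS => hx S hS⟩)
  refine ⟨b', sameType_of_definable_imp fun S hS hb => hb' S ⟨hS.mono hCB, hbQ S hS hb⟩,
    Q, hQ, fun S hS hbS => ?_⟩
  by_contra hn
  rw [← Ultrafilter.eventually_not] at hn
  exact hb' Sᶜ ⟨hS.compl, hn⟩ hbS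

/-- The principal ultrafilter at `b` is invariant because automorphisms over `M` fix `b`. -/
theorem hasInvariantExtension_of_range_subset (hb : range b ⊆ M) :
    HasInvariantExtension L M C b := by
  refine ⟨pure b, fun σ hσ φ => ?_, fun S _ hbS => hbS⟩
  have h1 : σ.symm ∘ b = b := by
    ext i
    have := hσ (b i) (hb (mem_range_self i))
    simp only [Function.comp_apply]
    conv_lhs => rw [← this]
    simp
  change φ.Realize b ↔ φ.Realize (σ.symm ∘ b)
  rw [h1]

/-- For finite `A` a global type is given by an ultrafilter on tuples of `𝕄`, as finitely many of
its formulas have a common solution there. -/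
theorem invIndep_iff [Nonempty 𝕄] {A : Set 𝕄} (hA : A.Finite) :
    InvIndep L A M B ↔ HasInvariantExtension L M (M ∪ B) (fun x : A => (x : 𝕄)) := by
  have : Finite A := hA
  have key : ∀ Q : Ultrafilter (A → 𝕄),
      (∀ S : Set (A → 𝕄), (M ∪ B).Definable L S → (∀ᶠ x in (Q : Filter (A → 𝕄)), x ∈ S) →
        (fun x : A => (x : 𝕄)) ∈ S) ↔
      ∀ S : Set (A → 𝕄), (M ∪ B).Definable L S → (fun x : A => (x : 𝕄)) ∈ S →
        ∀ᶠ x in (Q : Filter (A → 𝕄)), x ∈ S := by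
    intro Q
    constructor
    · intro h S hS ha
      by_contra hn
      rw [← Ultrafilter.eventually_not] at hn
      exact h Sᶜ hS.compl hn ha
    · intro h S hS hQS
      by_contra hn
      obtain ⟨x, hx, hx'⟩ := (hQS.and (h Sᶜ hS.compl hn)).exists
      exact hx' hx
  constructor
  · rintro ⟨q, hq, hqa⟩
    obtain ⟨Q, hQ⟩ := q.exists_isTypeOfUltrafilter
    exact ⟨Q, hQ.isInvariant_iff.1 hq, (key Q).1 (hQ.realizesRestrict_iff.1 hqa)⟩
  · rintro ⟨Q, hQ, hQa⟩
    obtain ⟨q, hq⟩ := exists_isTypeOfUltrafilter_globalType (L := L) Q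
    exact ⟨q, hq.isInvariant_iff.2 hQ, hq.realizesRestrict_iff.2 ((key Q).2 hQa)⟩

theorem invIndep_range_iff [Nonempty 𝕄] [Finite ι] :
    InvIndep L (range b) M B ↔ HasInvariantExtension L M (M ∪ B) b := by
  rw [invIndep_iff (finite_range b)]
  constructor
  · exact fun h => h.comp (rangeFactorization b)
  · intro h
    have := h.comp (rangeSplitting b)
    rwa [comp_rangeSplitting] at this

theorem isIndepOver_invIndep [Nonempty 𝕄] {κ : Cardinal.{w}} (h𝕄 : IsMonster L 𝕄 κ)
    (M : L.ElementarySubstructure 𝕄) (hM : #(M : Set 𝕄) < κ) :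
    IsIndepOver κ (InvIndep L) M where
  invariant := by
    intro σ hσ A B hA _ h
    have h1 := ((invIndep_iff hA).1 h).image σ hσ
    have h2 : σ '' (M : Set 𝕄) = M := image_equiv_eq_self σ hσ
    rw [image_union, h2] at h1
    have : Finite A := hA
    have h3 := invIndep_range_iff.2 h1
    rwa [range_comp, Subtype.range_coe] at h3
  left_mono := by
    intro A A' B hA _ h hAA
    rw [invIndep_iff hA] at h
    rw [invIndep_iff (hA.subset hAA)]
    exact h.comp (inclusion hAA)
  right_mono := by
    intro A B B' hA _ h hBB
    rw [invIndep_iff hA] at h ⊢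
    exact h.mono (union_subset_union_right _ hBB)
  strongFiniteCharacter := by
    intro ι _ b B _ h
    simp only [invIndep_range_iff] at h ⊢
    exact HasInvariantExtension.exists_definable_forcing h
  extension := by
    intro ι _ b B B' hB' h hBB
    simp only [invIndep_range_iff] at h ⊢
    exact h.exists_extension h𝕄 (h𝕄.card_union_lt hM hB') (union_subset_union_right _ hBB)
  of_subset := by
    intro A B hA _ hAM
    rw [invIndep_iff hA]
    exact hasInvariantExtension_of_range_subset (by rwa [Subtype.range_coe])

end Invariant

end AbsIndep

theorem mainTheorem2 {L : FirstOrder.Language.{u, v}} {𝕄 : Type w} [L.Structure 𝕄] [Nonempty 𝕄]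
    (κ : Cardinal.{w}) (h𝕄 : AbsIndep.IsMonster L 𝕄 κ) :
    (∀ Ind : AbsIndep.TernaryRel 𝕄,
      AbsIndep.IsIndependenceRelation L Ind →
      AbsIndep.FullExistence L κ Ind →
      AbsIndep.Monotonicity L κ Ind →
      AbsIndep.StrongFiniteCharacter L κ Ind →
      AbsIndep.RightExtension L κ Ind →
      AbsIndep.ChainLocalCharacter L κ (AbsIndep.ConantIndep L κ Ind)) ∧
    AbsIndep.ChainLocalCharacter L κ
      (AbsIndep.ConantIndep L κ (AbsIndep.InvIndep L (𝕄 := 𝕄))) :=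
  ⟨fun _ hinv hex hmono hsfc hext => AbsIndep.chainLocalCharacter_conantIndep h𝕄
    (AbsIndep.isIndepOver_of_axioms h𝕄 hinv hex hmono hsfc hext),
    AbsIndep.chainLocalCharacter_conantIndep h𝕄 (AbsIndep.isIndepOver_invIndep h𝕄)⟩
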